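/- **Theorem.** Let $0\le m\le n$ be integers. *Notation (symmetric group side).* For $0\le m\le n$ let $M^{n-m,m}$ be the space of complex functions on the set of $m$-subsets of $\{1,\dots,n\}$, with Dirac functions $\delta_X$; put $d\,\delta_X=\sum_{x\in X}\delta_{X\setminus\{x\}}$, $d^*\delta_X=\sum_{x\notin X}\delta_{X\cup\{x\}}$, $R_q=(d^*)^q/q!$ and $S^{n-k,k}=M^{n-k,k}\cap\operatorname{Ker}d$. The Hahn polynomials are $$E_m(a,b,c,x)=\sum_{j=\max\{0,x-c+m\}}^{\min\{m,x\}}(-1)^j\binom mj(b-m+1)_j(-x)_j(a-m+1)_{m-j}(x-c)_{m-j},\qquad (y)_k=y(y+1)\cdots(y+k-1).$$ *Notation ($SU(2)$ side).* For $l\in\{0,\frac12,1,\dots\}$ let $V_l$ be the space of homogeneous polynomials of degree $2l$ in $x,y$, with the representation $[T^l(g)P](x,y)=P(ax+cy,bx+dy)$ for $g=\bigl(\begin{smallmatrix}a&b\\c&d\end{smallmatrix}\bigr)\in SU(2)$, and with the scalar product for which the vectors $\psi^l_j=\sqrt{\binom{2l}{l-j}}\,x^{l-j}y^{l+j}$ ($j=-l,-l+1,\dots,l$)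 are orthonormal. The variables of the two factors of $V_{l_1}\otimes V_{l_2}$ are written $x_1,y_1$ and $x_2,y_2$. The Clebsch–Gordan coefficients are $C^{l_1,l_2,l}_{j_1,j_2,j}=\langle\Phi\psi^l_j,\psi^{l_1}_{j_1}\otimes\psi^{l_2}_{j_2}\rangle$ (the scalar product being linear in the first argument), where $\Phi:V_l\to V_{l_1}\otimes V_{l_2}$ is the isometric $SU(2)$-intertwining map with $\langle\Phi\psi^l_l,\psi^{l_1}_{l_1}\otimes\psi^{l_2}_{l-l_1}\rangle>0$. For $0\le h\le n$ put $A=\{1,\dots,h\}$, $B=\{h+1,\dots,n\}$ and let $\mathcal X_h:M^{n-m,m}\to V_{\frac{n-m}2}\otimes V_{\frac m2}$ (defined for every $m$) be the linear map with $$\mathcal X_h\delta_X=x_1^{|X^C\cap A|}y_1^{|X^C\cap B|}\otimes x_2^{|X\cap A|}y_2^{|X\cap B|}.$$ Put $D=x_1\frac{\partial}{\partial x_2}+y_1\frac{\partial}{\partial y_2}$ and $D^*=x_2\frac{\partial}{\partial x_1}+y_2\frac{\partial}{\partial y_1}$. *Claim.* 1. $M^{n-m,m}=\bigoplus_{k=0}^{\min\{n-m,m\}}R_{m-k}S^{n-k,k}$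 and $$V_{\frac{n-m}2}\otimes V_{\frac m2}=\bigoplus_{k=0}^{\min\{n-m,m\}}(D^*)^{m-k}\bigl[(V_{\frac{n-k}2}\otimes V_{\frac k2})\cap\operatorname{Ker}D\bigr].$$ 2. For $0\le k\le\min\{n-m,m\}$, the space $(V_{\frac{n-k}2}\otimes V_{\frac k2})\cap\operatorname{Ker}D$ and the $k$-th summand of the second decomposition are $SU(2)$-invariant and isomorphic to $V_{\frac n2-k}$; so the second decomposition is the Clebsch–Gordan decomposition. It corresponds to the first one under the maps $\mathcal X_h$: $$(V_{\frac{n-k}2}\otimes V_{\frac k2})\cap\operatorname{Ker}D=\bigoplus_{h=k}^{n-k}\mathcal X_hS^{n-k,k},\qquad (D^*)^{m-k}\bigl[(V_{\frac{n-k}2}\otimes V_{\frac k2})\cap\operatorname{Ker}D\bigr]=\bigoplus_{h=k}^{n-k}\mathcal X_hR_{m-k}S^{n-k,k}.$$ 3. For $0\le k\le\min\{n-m,m\}$ the map $\Phi$ above exists and is unique for $(l_1,l_2,l)=(\frac{n-m}2,\frac m2,\frac n2-k)$, and for all integers $h,w$ with $k\le h\le n-k$ and $\max\{0,m-h\}\le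 w\le\min\{n-h,m\}$ $$C^{\frac{n-m}{2},\frac{m}{2},\frac{n}{2}-k}_{\frac{n+m}{2}-h-w,\;w-\frac{m}{2},\;\frac{n}{2}-h}=(-1)^k\left[\frac{(h-k)!\,(n-h-k)!\,(m-k)!\,(n-m-k)!\,(n-2k+1)}{(m-w)!\,(h-m+w)!\,(n-h-w)!\,w!\,(n-k+1)!\,k!}\right]^{1/2}E_k(n-h,h,m,w).$$ -/

import Mathlib

open scoped TensorProduct ComplexConjugate ComplexOrder

noncomputable section

namespace HahnClebschGordan

/-! ### Hahn polynomials -/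

/-- The Hahn polynomial `E_m(a,b,c,x)` in Dunkl's normalization; `(ascPochhammer ℤ k).eval y`
is the rising factorial `(y)_k = y (y+1) ⋯ (y+k-1)`, and the truncated lower limit of the sum is
`max {0, x - c + m}`. -/
def hahnE (m a b c x : ℕ) : ℤ :=
  ∑ j ∈ Finset.Icc (x + m - c) (min m x),
    (-1) ^ j * (m.choose j : ℤ) * (ascPochhammer ℤ j).eval ((b : ℤ) - m + 1)
      * (ascPochhammer ℤ j).eval (-(x : ℤ))
      * (ascPochhammer ℤ (m - j)).eval ((a : ℤ) - m + 1)
      * (ascPochhammer ℤ (m - j)).eval ((x : ℤ) - c)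

/-! ### The Johnson scheme -/

/-- Complex functions on all subsets of an `n`-element set; it is the direct sum of the modules
`M^{n-m,m}`, `0 ≤ m ≤ n`. -/
abbrev SubsetFun (n : ℕ) : Type := Finset (Fin n) → ℂ

/-- The permutation module `M^{n-m,m}`: functions living on the `m`-subsets. -/
def johnsonM (n m : ℕ) : Submodule ℂ (SubsetFun n) where
  carrier := {f | ∀ X : Finset (Fin n), X.card ≠ m → f X = 0}
  add_mem' := by
    intro f g hf hg X hX
    simp [hf X hX, hg X hX]
  zero_mem' := by
    intro X _
    rfl
  smul_mem' := by
    intro c f hf X hX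
    simp [hf X hX]

/-- The Dirac function `δ_X`. -/
def dirac {n : ℕ} (X : Finset (Fin n)) : SubsetFun n := Pi.single X 1

/-- The Radon transform `d δ_X = ∑_{x ∈ X} δ_{X \ {x}}`. -/
def radonD (n : ℕ) : SubsetFun n →ₗ[ℂ] SubsetFun n :=
  Fintype.linearCombination ℂ fun X : Finset (Fin n) => ∑ x ∈ X, dirac (X.erase x)

/-- The adjoint transform `d* δ_X = ∑_{x ∉ X} δ_{X ∪ {x}}`. -/
def radonDStar (n : ℕ) : SubsetFun n →ₗ[ℂ] SubsetFun n :=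
  Fintype.linearCombination ℂ fun X : Finset (Fin n) => ∑ x ∈ Xᶜ, dirac (insert x X)

/-- `R_q = (d*)^q / q!`. -/
def radonR (n q : ℕ) : SubsetFun n →ₗ[ℂ] SubsetFun n :=
  ((q.factorial : ℂ)⁻¹) • (radonDStar n ^ q)

/-- `S^{n-k,k} = M^{n-k,k} ∩ Ker d`. -/
def specht (n k : ℕ) : Submodule ℂ (SubsetFun n) :=
  johnsonM n k ⊓ LinearMap.ker (radonD n)

/-- The summand `R_{m-k} S^{n-k,k}` of `M^{n-m,m}`. -/
def johnsonSummand (n m k : ℕ) : Submodule ℂ (SubsetFun n) :=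
  (specht n k).map (radonR n (m - k))

/-! ### The representations of `SU(2)` on binary forms -/

/-- Polynomials in the two variables `x = X 0`, `y = X 1`. -/
abbrev Pol : Type := MvPolynomial (Fin 2) ℂ

/-- The group `SU(2)`. -/
abbrev SU2 : Type := Matrix.specialUnitaryGroup (Fin 2) ℂ

/-- The substitution `P(x,y) ↦ P(ax + cy, bx + dy)` for the matrix with rows `(a,b)`, `(c,d)`:
the variable with index `i` is replaced by `∑ j, g j i * X j`. -/
def subst (g : Matrix (Fin 2) (Fin 2) ℂ) : Pol →ₐ[ℂ] Pol :=
  MvPolynomial.aeval fun i => ∑ j, MvPolynomial.C (g j i) * MvPolynomial.X j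

theorem subst_one : subst 1 = AlgHom.id ℂ Pol := by
  apply MvPolynomial.algHom_ext
  intro i
  fin_cases i <;> simp [subst, Fin.sum_univ_two]

theorem subst_mul (g h : Matrix (Fin 2) (Fin 2) ℂ) :
    subst (g * h) = (subst g).comp (subst h) := by
  apply MvPolynomial.algHom_ext
  intro i
  simp only [subst, MvPolynomial.aeval_X, AlgHom.comp_apply, map_mul,
    MvPolynomial.algHom_C, Matrix.mul_apply, Fin.sum_univ_two, map_add,
    MvPolynomial.algebraMap_eq]
  ring

/-- The action of `SU(2)` on all polynomials in two variables. -/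
def polRep : Representation ℂ SU2 Pol where
  toFun g := (subst (g : Matrix (Fin 2) (Fin 2) ℂ)).toLinearMap
  map_one' := by
    rw [Submonoid.coe_one, subst_one]
    rfl
  map_mul' g h := by
    rw [Submonoid.coe_mul, subst_mul]
    rfl

/-- The space `V_{d/2}` of homogeneous polynomials of degree `d` in two variables, so that the
spin is `l = d/2`. -/
def V (d : ℕ) : Submodule ℂ Pol := MvPolynomial.homogeneousSubmodule (Fin 2) ℂ d

theorem subst_mem_V (g : Matrix (Fin 2) (Fin 2) ℂ) (d : ℕ) {P : Pol} (hP : P ∈ V d) :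
    subst g P ∈ V d := by
  rw [V, MvPolynomial.mem_homogeneousSubmodule] at hP ⊢
  have h := hP.aeval (n := 1)
    (fun i => ∑ j, MvPolynomial.C (g j i) * (MvPolynomial.X j : Pol))
    (fun i => MvPolynomial.IsHomogeneous.sum _ _ _
      fun j _ => (MvPolynomial.isHomogeneous_X ℂ j).C_mul _)
  simpa [subst] using h

/-- `V_{d/2}` as an `SU(2)`-subrepresentation of the space of polynomials. -/
def spinSub (d : ℕ) : Subrepresentation polRep where
  toSubmodule := V d
  apply_mem_toSubmodule g _ hP := subst_mem_V g d hP

/-- The representation `T^{d/2}` of `SU(2)` on `V_{d/2}`. -/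
def spinRep (d : ℕ) : Representation ℂ SU2 (V d) := (spinSub d).toRepresentation

/-- The ambient space of `V_{a/2} ⊗ V_{b/2}`; the variables of the first factor are
`x₁, y₁`, those of the second factor `x₂, y₂`. -/
abbrev Pol2 : Type := Pol ⊗[ℂ] Pol

/-- The tensor product action of `SU(2)`. -/
def tensorRep : Representation ℂ SU2 Pol2 := polRep.tprod polRep

/-- `V_{a/2} ⊗ V_{b/2}`, as a subspace of the tensor square of the space of polynomials. -/
def tens (a b : ℕ) : Submodule ℂ Pol2 := LinearMap.range (TensorProduct.mapIncl (V a) (V b))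

/-- `W` is invariant under `SU(2)`, and isomorphic to `V_{d/2}` as a representation. -/
def IsoSpin (W : Submodule ℂ Pol2) (d : ℕ) : Prop :=
  ∃ W' : Subrepresentation tensorRep, W'.toSubmodule = W ∧
    Nonempty ((spinRep d).Equiv W'.toRepresentation)

/-! ### The Schur--Weyl map and the polarization operators -/

/-- The monomial `x^p y^q`. -/
def mono (p q : ℕ) : Pol := MvPolynomial.X 0 ^ p * MvPolynomial.X 1 ^ q

/-- The set `A = {1, …, h}` (in zero-based numbering); its complement is `B = {h+1, …, n}`. -/
def setA (n h : ℕ) : Finset (Fin n) := Finset.univ.filter fun i => i.val < h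

/-- The map `X_h`: the exponents of `x₁, y₁, x₂, y₂` in the image of `δ_X` are the cardinalities
of `Xᶜ ∩ A`, `Xᶜ ∩ B`, `X ∩ A`, `X ∩ B`. It maps `M^{n-m,m}` into `V_{(n-m)/2} ⊗ V_{m/2}`. -/
def schurWeyl (n h : ℕ) : SubsetFun n →ₗ[ℂ] Pol2 :=
  Fintype.linearCombination ℂ fun X : Finset (Fin n) =>
    mono (Xᶜ ∩ setA n h).card (Xᶜ ∩ (setA n h)ᶜ).card ⊗ₜ[ℂ]
      mono (X ∩ setA n h).card (X ∩ (setA n h)ᶜ).card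

/-- The operator `x₁ ∂/∂x₂ + y₁ ∂/∂y₂`. -/
def polarLower : Pol2 →ₗ[ℂ] Pol2 :=
  ∑ i : Fin 2, TensorProduct.map (LinearMap.mulLeft ℂ (MvPolynomial.X i : Pol))
    (MvPolynomial.pderiv i : Derivation ℂ Pol Pol).toLinearMap

/-- The operator `x₂ ∂/∂x₁ + y₂ ∂/∂y₁`. -/
def polarRaise : Pol2 →ₗ[ℂ] Pol2 :=
  ∑ i : Fin 2, TensorProduct.map (MvPolynomial.pderiv i : Derivation ℂ Pol Pol).toLinearMap
    (LinearMap.mulLeft ℂ (MvPolynomial.X i : Pol))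

/-- `(V_{(n-k)/2} ⊗ V_{k/2}) ∩ Ker (x₁ ∂/∂x₂ + y₁ ∂/∂y₂)`. -/
def polarKer (n k : ℕ) : Submodule ℂ Pol2 := tens (n - k) k ⊓ LinearMap.ker polarLower

/-- The `k`-th summand
`(x₂ ∂/∂x₁ + y₂ ∂/∂y₁)^{m-k} [(V_{(n-k)/2} ⊗ V_{k/2}) ∩ Ker (x₁ ∂/∂x₂ + y₁ ∂/∂y₂)]`. -/
def cgSummand (n m k : ℕ) : Submodule ℂ Pol2 := (polarKer n k).map (polarRaise ^ (m - k))

/-! ### The scalar product and the Clebsch--Gordan coefficients -/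

/-- The scalar product on polynomials in which the monomials are orthogonal and
`x^p y^q` has square norm `1 / binom(p+q, p)`. On `V_{d/2}` it is the scalar product in which the
vectors `√binom(d, q) x^{d-q} y^q` form an orthonormal basis (see `inner_psi`). -/
def polInner (P Q : Pol) : ℂ :=
  ∑ e ∈ P.support, conj (P.coeff e) * Q.coeff e / ((e 0 + e 1).choose (e 0) : ℂ)

theorem polInner_eq_sum (P Q : Pol) (s : Finset (Fin 2 →₀ ℕ)) (hs : P.support ⊆ s) :
    polInner P Q
      = ∑ e ∈ s, conj (P.coeff e) * Q.coeff e / ((e 0 + e 1).choose (e 0) : ℂ) := by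
  refine Finset.sum_subset hs ?_
  intro e _ he
  have h0 : P.coeff e = 0 := by simpa using he
  simp [h0]

theorem polInner_self (P : Pol) :
    polInner P P = ((∑ e ∈ P.support,
      Complex.normSq (P.coeff e) / ((e 0 + e 1).choose (e 0) : ℝ) : ℝ) : ℂ) := by
  rw [polInner_eq_sum P P P.support subset_rfl]
  push_cast
  refine Finset.sum_congr rfl fun e _ => ?_
  rw [Complex.normSq_eq_conj_mul_self]

/-- `polInner` is a scalar product. -/
@[reducible] def polCore : InnerProductSpace.Core ℂ Pol where
  inner := polInner
  conj_inner_symm P Q := by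
    classical
    rw [polInner_eq_sum Q P (P.support ∪ Q.support) Finset.subset_union_right,
      polInner_eq_sum P Q (P.support ∪ Q.support) Finset.subset_union_left, map_sum]
    refine Finset.sum_congr rfl fun e _ => ?_
    simp [mul_comm]
  re_inner_nonneg P := by
    rw [polInner_self]
    simp only [RCLike.re_to_complex, Complex.ofReal_re]
    exact Finset.sum_nonneg fun e _ => div_nonneg (Complex.normSq_nonneg _) (Nat.cast_nonneg _)
  add_left P Q S := by
    classical
    rw [polInner_eq_sum (P + Q) S (P.support ∪ Q.support) MvPolynomial.support_add,
      polInner_eq_sum P S (P.support ∪ Q.support) Finset.subset_union_left,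
      polInner_eq_sum Q S (P.support ∪ Q.support) Finset.subset_union_right,
      ← Finset.sum_add_distrib]
    refine Finset.sum_congr rfl fun e _ => ?_
    simp only [MvPolynomial.coeff_add, map_add]
    ring
  smul_left P Q r := by
    rw [polInner_eq_sum (r • P) Q P.support MvPolynomial.support_smul,
      polInner_eq_sum P Q P.support subset_rfl, Finset.mul_sum]
    refine Finset.sum_congr rfl fun e _ => ?_
    simp only [MvPolynomial.coeff_smul, smul_eq_mul, map_mul]
    ring
  definite P h := by
    rw [polInner_self, Complex.ofReal_eq_zero,
      Finset.sum_eq_zero_iff_of_nonneg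
        (fun e _ => div_nonneg (Complex.normSq_nonneg _) (Nat.cast_nonneg _))] at h
    ext e
    by_cases he : e ∈ P.support
    · have hc : ((e 0 + e 1).choose (e 0) : ℝ) ≠ 0 :=
        Nat.cast_ne_zero.mpr (Nat.choose_pos (Nat.le_add_right _ _)).ne'
      have := h e he
      rw [div_eq_zero_iff] at this
      simpa [hc] using this
    · simpa using he

instance polNormed : NormedAddCommGroup Pol := polCore.toNormedAddCommGroup

instance polInnerProductSpace : InnerProductSpace ℂ Pol := InnerProductSpace.ofCore polCore.toCore

/-- The vector `ψ^l_j = √binom(2l, l-j) x^{l-j} y^{l+j}` of `V_l`, with `d = 2l` and `q = l+j`. -/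
def psi (d q : ℕ) : Pol := (√(d.choose (d - q) : ℝ) : ℂ) • mono (d - q) q

theorem mono_mem_V {d q : ℕ} (hq : q ≤ d) : mono (d - q) q ∈ V d := by
  rw [V, MvPolynomial.mem_homogeneousSubmodule]
  have h := ((MvPolynomial.isHomogeneous_X ℂ (0 : Fin 2)).pow (d - q)).mul
    ((MvPolynomial.isHomogeneous_X ℂ (1 : Fin 2)).pow q)
  have e : 1 * (d - q) + 1 * q = d := by omega
  rwa [e] at h

theorem psi_mem_V {d q : ℕ} (hq : q ≤ d) : psi d q ∈ V d :=
  (V d).smul_mem _ (mono_mem_V hq)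

theorem inner_eq_polInner (P Q : Pol) : inner ℂ P Q = polInner P Q := rfl

theorem mono_eq (p q : ℕ) : mono p q
    = MvPolynomial.monomial (Finsupp.single 0 p + Finsupp.single 1 q) (1 : ℂ) := by
  simp [mono, MvPolynomial.X_pow_eq_monomial, MvPolynomial.monomial_mul]

theorem inner_mono (p q p' q' : ℕ) : inner ℂ (mono p q) (mono p' q')
    = if p = p' ∧ q = q' then (((p + q).choose p : ℂ))⁻¹ else 0 := by
  rw [inner_eq_polInner, mono_eq, mono_eq, polInner_eq_sum _ _ _ MvPolynomial.support_monomial_subset,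
    Finset.sum_singleton]
  have hiff : (Finsupp.single (0 : Fin 2) p' + Finsupp.single 1 q'
      = Finsupp.single 0 p + Finsupp.single 1 q) ↔ (p = p' ∧ q = q') := by
    constructor
    · intro h
      have h0 := DFunLike.congr_fun h 0
      have h1 := DFunLike.congr_fun h 1
      simp at h0 h1
      exact ⟨h0.symm, h1.symm⟩
    · rintro ⟨rfl, rfl⟩
      rfl
  simp only [MvPolynomial.coeff_monomial, hiff]
  split_ifs <;> simp

/-- The vectors `ψ^l_j` of `V_l` are orthonormal. -/
theorem inner_psi {d q q' : ℕ} (hq : q ≤ d) (hq' : q' ≤ d) :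
    inner ℂ (psi d q) (psi d q') = if q = q' then (1 : ℂ) else 0 := by
  have hc : (d.choose (d - q) : ℂ) ≠ 0 := Nat.cast_ne_zero.mpr (Nat.choose_pos (Nat.sub_le _ _)).ne'
  rw [psi, psi, inner_smul_left, inner_smul_right, inner_mono]
  by_cases h : q = q'
  · subst h
    have hs : ((√(d.choose (d - q) : ℝ) : ℝ) : ℂ) * ((√(d.choose (d - q) : ℝ) : ℝ) : ℂ)
        = (d.choose (d - q) : ℂ) := by
      rw [← Complex.ofReal_mul, Real.mul_self_sqrt (Nat.cast_nonneg _)]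
      simp
    simp only [and_self, if_true, Complex.conj_ofReal, Nat.sub_add_cancel hq]
    rw [← mul_assoc, hs, mul_inv_cancel₀ hc]
  · simp [h]

/-- `ψ^l_j` as an element of `V_l`; it is zero outside of the range `|j| ≤ l`. -/
def psiV (d q : ℕ) : V d := if hq : q ≤ d then ⟨psi d q, psi_mem_V hq⟩ else 0

/-- `Φ` is the isometric `SU(2)`-intertwining map of `V_l` into `V_{l₁} ⊗ V_{l₂}` that satisfies the
positivity condition `⟨Φ ψ^l_l, ψ^{l₁}_{l₁} ⊗ ψ^{l₂}_{l-l₁}⟩ > 0`;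
here `d₁ = 2 l₁`, `d₂ = 2 l₂`, `d = 2 l`, and `l₂ + (l - l₁) = (d₂ + d - d₁)/2`. -/
def IsCGMap (d₁ d₂ d : ℕ) (Φ : V d →ₗ[ℂ] Pol2) : Prop :=
  (∀ v : V d, Φ v ∈ tens d₁ d₂) ∧
    (∀ v v' : V d, inner ℂ (Φ v) (Φ v') = inner ℂ (v : Pol) (v' : Pol)) ∧
    (∀ (g : SU2) (v : V d), Φ (spinRep d g v) = tensorRep g (Φ v)) ∧
    0 < inner ℂ (psi d₁ d₁ ⊗ₜ[ℂ] psi d₂ ((d₂ + d - d₁) / 2)) (Φ (psiV d d))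

open Classical in
/-- The coefficient of `ψ^{l₁}_{j₁} ⊗ ψ^{l₂}_{j₂}` in `φ^{l₁,l₂,l}_j = Φ ψ^l_j`, with
`d = 2l`, `q = l + j` and similarly for the other two pairs. -/
def cgCoeff (d₁ d₂ d q₁ q₂ q : ℕ) : ℂ :=
  if hΦ : ∃ Φ : V d →ₗ[ℂ] Pol2, IsCGMap d₁ d₂ d Φ then
    inner ℂ (psi d₁ q₁ ⊗ₜ[ℂ] psi d₂ q₂) (hΦ.choose (psiV d q))
  else 0

/-- The Clebsch--Gordan coefficient `C^{l₁,l₂,l}_{j₁,j₂,j}`, for half-integers `l₁, l₂, l ≥ 0` and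
`j₁, j₂, j` with `|j₁| ≤ l₁`, `|j₂| ≤ l₂`, `|j| ≤ l` and `l₁ - j₁`, `l₂ - j₂`, `l - j` integers. -/
def clebschGordan (l₁ l₂ l j₁ j₂ j : ℚ) : ℂ :=
  cgCoeff ⌊2 * l₁⌋₊ ⌊2 * l₂⌋₊ ⌊2 * l⌋₊ ⌊l₁ + j₁⌋₊ ⌊l₂ + j₂⌋₊ ⌊l + j⌋₊

end HahnClebschGordan

end

noncomputable section

namespace HahnClebschGordan

/-! ### Lowering and raising operators on a graded space -/

/-! Both direct sum decompositions are instances of one statement about ladders of `sl₂` type. On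
the spaces `M^{n-m,m}` (with `d`, `d*`) and on `V_{(n-m)/2} ⊗ V_{m/2}` (with `D`, `D*`) the
commutator of lowering and raising is the scalar `n - 2m` in degree `m`. Hence `R L` acts on the
`k`-th summand by `(m-k)(n-m-k+1)`. These scalars differ for different `k ≤ min(n-m, m)`, which
gives independence (`IsLadder.iSupIndep_summand`); an induction on the degree shows that the
summands exhaust the space (`IsLadder.iSup_summand`).

On the `SU(2)` side put `Δ = x₁y₂ - y₁x₂`. An element of `Ker D` is determined by its terms free of
`x₂`, so the kernel in bidegree `(n-k, k)` is `Δ^k` times the forms of degree `n - 2k` in `x₁, y₁`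
(`polarKer_eq_map`). Since `Δ` and `D*` are `SU(2)`-invariant, `P ↦ (D*)^{m-k}(Δ^k P(x₁, y₁))`
(`cgMap`) is an injective intertwining map onto the `k`-th summand.

The maps `X_h` carry `d`, `d*` to `D`, `D*` and land in total degree `h` in `x₁, x₂`, so different
`h` give independent images. For `k ≤ h ≤ n-k` the kernel meets that degree in a line, and `X_h` of
an explicit vector of `S^{n-k,k}` is a nonzero element of it (`kerEmb_mono_mem_map_schurWeyl`).

For the coefficients, `cgMap` multiplies the scalar product by a constant (`inner_cgMap`), because
`D` and `D*` are adjoint up to degree-dependent factors and the norm of `Δ^k x₁^p y₁^q` is a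
summable binomial expression. Rescaling and the sign `(-1)^k` yield the required isometry. It is
unique because an intertwining map is determined by one number, the value of the image of a single
monomial at the pair `(1,0), (0,1)` (`IsCGMap.unique`). The Clebsch–Gordan coefficients are
therefore normalized monomial coefficients of `(D*)^{m-k}(Δ^k x₁^{h-k} y₁^{n-h-k})`, and expanding
these gives the Hahn sum (`bicoeff_raise_kerEmb`, `hahnE_mul_factorial`). -/

/-- The operators `L` and `R` lower and raise the degree on the spaces `G 0, …, G n`, and
`L R - R L` is the scalar `n - 2 m` on `G m`. -/
structure IsLadder {U : Type*} [AddCommGroup U] [Module ℂ U] (n : ℕ) (G : ℕ → Submodule ℂ U)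
    (L R : Module.End ℂ U) : Prop where
  lower : ∀ m, ∀ x ∈ G (m + 1), L x ∈ G m
  lower_zero : ∀ x ∈ G 0, L x = 0
  raise : ∀ m, ∀ x ∈ G m, R x ∈ G (m + 1)
  vanish : ∀ m, n < m → ∀ x ∈ G m, x = 0
  comm : ∀ m, ∀ x ∈ G m, L (R x) = R (L x) + ((n : ℂ) - 2 * m) • x

namespace IsLadder

variable {U : Type*} [AddCommGroup U] [Module ℂ U] {n : ℕ} {G : ℕ → Submodule ℂ U}
  {L R : Module.End ℂ U}

theorem pow_mem (H : IsLadder n G L R) {m : ℕ} {x : U} (hx : x ∈ G m) (q : ℕ) :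
    (R ^ q) x ∈ G (m + q) := by
  induction q with
  | zero => simpa using hx
  | succ q ih => rw [pow_succ', Module.End.mul_apply]; exact H.raise _ _ ih

/-- Moving `L` past the factors `R` one at a time contributes `n - 2m, n - 2(m+1), …, n - 2(m+q)`,
whose sum is `(q+1)(n - 2m - q)`. -/
theorem lower_pow (H : IsLadder n G L R) {m : ℕ} {x : U} (hx : x ∈ G m) (q : ℕ) :
    L ((R ^ (q + 1)) x)
      = (((q : ℂ) + 1) * ((n : ℂ) - 2 * m - q)) • (R ^ q) x + (R ^ (q + 1)) (L x) := by
  induction q with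
  | zero => simpa [add_comm] using H.comm m x hx
  | succ q ih =>
    rw [pow_succ' R (q + 1), Module.End.mul_apply, H.comm _ _ (H.pow_mem hx (q + 1)), ih,
      map_add, map_smul, Module.End.mul_apply, ← Module.End.mul_apply R (R ^ q), ← pow_succ']
    push_cast
    module

/-- The lowest vectors of degree `k`. -/
def primitive (G : ℕ → Submodule ℂ U) (L : Module.End ℂ U) (k : ℕ) : Submodule ℂ U :=
  G k ⊓ LinearMap.ker L

theorem lower_pow_primitive (H : IsLadder n G L R) {k : ℕ} {x : U} (hx : x ∈ primitive G L k)
    (q : ℕ) : L ((R ^ (q + 1)) x) = (((q : ℂ) + 1) * ((n : ℂ) - 2 * k - q)) • (R ^ q) x := by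
  rw [H.lower_pow hx.1, LinearMap.mem_ker.mp hx.2, map_zero, add_zero]

/-- Above the middle degree, `R L` is injective. -/
theorem eq_zero_of_raise_lower (H : IsLadder n G L R) {m : ℕ} (hm : n < 2 * m) {x : U}
    (hx : x ∈ G m) (h : R (L x) = 0) : x = 0 := by
  -- Descent on the power: applying `L` to `R^{q+1} x = 0`, the term `R^{q+1} L x` drops out because
  -- `R L x = 0`, and the factor of `R^q x` is nonzero because `n - 2m - q < 0`. The descent can
  -- start at `q = n + 1`, where the grading has ended.
  have key : ∀ q, (R ^ q) x = 0 → x = 0 := by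
    intro q
    induction q with
    | zero => simp
    | succ q ih =>
      intro hq
      apply ih
      have h1 := H.lower_pow hx q
      rw [hq, map_zero, pow_succ, Module.End.mul_apply, h, map_zero, add_zero] at h1
      refine (smul_eq_zero.mp h1.symm).resolve_left (mul_ne_zero (by positivity) ?_)
      have : (n : ℂ) - 2 * m - q = -((2 * m + q - n : ℕ) : ℂ) := by
        rw [Nat.cast_sub (by omega)]; push_cast; ring
      rw [this, neg_ne_zero, Nat.cast_ne_zero]
      omega
  exact key (n + 1) (H.vanish _ (by omega) _ (H.pow_mem hx (n + 1)))

/-- The `k`-th summand of `G m`. -/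
def summand (G : ℕ → Submodule ℂ U) (L R : Module.End ℂ U) (m k : ℕ) : Submodule ℂ U :=
  (primitive G L k).map (R ^ (m - k))

theorem pow_mem_summand {m k : ℕ} {x : U} (hx : x ∈ primitive G L k) :
    (R ^ (m - k)) x ∈ summand G L R m k :=
  Submodule.mem_map_of_mem hx

theorem summand_le (H : IsLadder n G L R) {m k : ℕ} (hk : k ≤ m) : summand G L R m k ≤ G m := by
  rintro _ ⟨x, hx, rfl⟩
  have := H.pow_mem hx.1 (m - k)
  rwa [Nat.add_sub_cancel' hk] at this

/-- `L` takes `R^q v`, with `v` primitive, to a multiple of `R^{q-1} v`, and `R` restores the lost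
power. So each summand lies in an eigenspace of `R L`, which separates different `k`. -/
theorem raise_lower_eq_smul (H : IsLadder n G L R) {m k : ℕ} (hk : k ≤ m) {x : U}
    (hx : x ∈ summand G L R m k) :
    R (L x) = (((m : ℂ) - k) * ((n : ℂ) - m - k + 1)) • x := by
  obtain ⟨v, hv, rfl⟩ := hx
  obtain ⟨q, rfl⟩ := Nat.exists_eq_add_of_le hk
  rw [Nat.add_sub_cancel_left]
  cases q with
  | zero => simp [LinearMap.mem_ker.mp hv.2]
  | succ q =>
    rw [H.lower_pow_primitive hv, map_smul, ← Module.End.mul_apply, ← pow_succ']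
    push_cast
    congr 1
    ring

theorem iSupIndep_summand (H : IsLadder n G L R) (m : ℕ) :
    iSupIndep (fun k : Fin (min (n - m) m + 1) => summand G L R m k) := by
  have hinj : Function.Injective
      (fun k : Fin (min (n - m) m + 1) => ((m : ℂ) - k) * ((n : ℂ) - m - k + 1)) := by
    intro a b hab
    by_contra hne
    have ha := a.2
    have hb := b.2
    have h1 : ((m : ℤ) - a) * ((n : ℤ) - m - a + 1) = ((m : ℤ) - b) * ((n : ℤ) - m - b + 1) := by
      have hab' : ((m : ℂ) - (a : ℕ)) * ((n : ℂ) - m - (a : ℕ) + 1)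
          = ((m : ℂ) - (b : ℕ)) * ((n : ℂ) - m - (b : ℕ) + 1) := hab
      have : (((((m : ℤ) - a) * ((n : ℤ) - m - a + 1) : ℤ)) : ℂ)
          = ((((m : ℤ) - b) * ((n : ℤ) - m - b + 1) : ℤ) : ℂ) := by
        push_cast
        exact hab'
      exact Int.cast_injective this
    have h2 : ((a : ℤ) - b) * ((a : ℤ) + b - n - 1) = 0 := by linear_combination h1
    -- The second factor cannot vanish, since `a + b ≤ n`.
    rcases mul_eq_zero.mp h2 with h3 | h3
    · exact hne (Fin.ext (by omega))
    · omega
  refine ((Module.End.eigenspaces_iSupIndep (R * L)).comp hinj).mono fun k x hx => ?_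
  rw [Function.comp_apply, Module.End.mem_eigenspace_iff, Module.End.mul_apply]
  exact H.raise_lower_eq_smul (by have := k.2; omega) hx

/-- Induction on the degree: decompose `L x` and lift it to some `y` in the sum of the summands one
degree higher. If `2(m+1) ≤ n`, the lift is exact, so `x - y` is primitive and lies in the new
summand `k = m + 1`. Above the middle only `R L (x - y) = 0` is available, and there it forces `x =
y`. -/
theorem le_iSup_summand (H : IsLadder n G L R) (m : ℕ) (hm : m ≤ n) :
    G m ≤ ⨆ k : Fin (min (n - m) m + 1), summand G L R m k := by
  induction m with
  | zero =>
    intro x hx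
    refine Submodule.mem_iSup_of_mem ⟨0, by omega⟩ ?_
    simpa [summand, primitive] using And.intro hx (H.lower_zero x hx)
  | succ m ih =>
    intro x hx
    have key : ∀ z ∈ ⨆ k : Fin (min (n - m) m + 1), summand G L R m k,
        ∃ y ∈ ⨆ k : Fin (min (n - (m + 1)) (m + 1) + 1), summand G L R (m + 1) k,
          R (z - L y) = 0 ∧ (2 * (m + 1) ≤ n → z = L y) := by
      intro z hz
      refine Submodule.iSup_induction _
        (motive := fun z => ∃ y ∈ ⨆ k : Fin (min (n - (m + 1)) (m + 1) + 1),
          summand G L R (m + 1) k, R (z - L y) = 0 ∧ (2 * (m + 1) ≤ n → z = L y))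
        hz ?_ ⟨0, Submodule.zero_mem _, by simp, by simp⟩ ?_
      · rintro ⟨k, hk⟩ _ ⟨v, hv, rfl⟩
        simp only at hv ⊢
        obtain ⟨q, rfl⟩ := Nat.exists_eq_add_of_le (show k ≤ m by omega)
        rw [Nat.add_sub_cancel_left]
        -- If `2k + q < n`, a multiple of `R^{q+1} v` is a preimage of `R^q v` under `L`. Otherwise
        -- `2k + q = n`: the string ends, `R^{q+1} v = 0`, and the lift `0` suffices; this does not
        -- occur when `2(m+1) ≤ n`.
        by_cases hkm : k + q + k + 1 ≤ n
        · have hc : ((q : ℂ) + 1) * ((n : ℂ) - 2 * k - q) ≠ 0 := by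
            refine mul_ne_zero (by positivity) ?_
            have : (n : ℂ) - 2 * k - q = ((n - 2 * k - q : ℕ) : ℂ) := by
              rw [Nat.cast_sub (by omega), Nat.cast_sub (by omega)]; push_cast; ring
            rw [this, Nat.cast_ne_zero]
            omega
          have hy : L ((((q : ℂ) + 1) * ((n : ℂ) - 2 * k - q))⁻¹ • (R ^ (q + 1)) v) = (R ^ q) v := by
            rw [map_smul, H.lower_pow_primitive hv, inv_smul_smul₀ hc]
          refine ⟨_, Submodule.smul_mem _ _ (Submodule.mem_iSup_of_mem ⟨k, by omega⟩ ?_),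
            ?_, fun _ => hy.symm⟩
          · have := pow_mem_summand (R := R) (m := k + q + 1) hv
            rwa [show k + q + 1 - k = q + 1 by omega] at this
          · rw [hy, sub_self, map_zero]
        · refine ⟨0, Submodule.zero_mem _, ?_, fun h => by omega⟩
          rw [map_zero, sub_zero, ← Module.End.mul_apply, ← pow_succ']
          refine H.eq_zero_of_raise_lower (m := k + (q + 1)) (by omega) (H.pow_mem hv.1 _) ?_
          rw [H.lower_pow_primitive hv]
          have : (n : ℂ) - 2 * k - q = 0 := by
            have : n = 2 * k + q := by omega
            rw [this]; push_cast; ring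
          rw [this, mul_zero, zero_smul, map_zero]
      · rintro z₁ z₂ ⟨y₁, hy₁, h₁, h₁'⟩ ⟨y₂, hy₂, h₂, h₂'⟩
        refine ⟨y₁ + y₂, Submodule.add_mem _ hy₁ hy₂, ?_, fun h => ?_⟩
        · rw [map_add, add_sub_add_comm, map_add, h₁, h₂, add_zero]
        · rw [map_add, ← h₁' h, ← h₂' h]
    obtain ⟨y, hy, h1, h2⟩ := key (L x) (ih (by omega) (H.lower m x hx))
    have hyG : y ∈ G (m + 1) := by
      refine (iSup_le fun k => H.summand_le ?_) hy
      have := k.2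
      omega
    rw [← sub_add_cancel x y]
    refine Submodule.add_mem _ ?_ hy
    by_cases hmn : 2 * (m + 1) ≤ n
    · refine Submodule.mem_iSup_of_mem ⟨m + 1, by omega⟩ ?_
      simp only [summand, Nat.sub_self, pow_zero]
      refine ⟨x - y, ⟨Submodule.sub_mem _ hx hyG, ?_⟩, rfl⟩
      exact LinearMap.mem_ker.mpr (by rw [map_sub, h2 hmn, sub_self])
    · rw [H.eq_zero_of_raise_lower (m := m + 1) (by omega) (Submodule.sub_mem _ hx hyG)
        (by rw [map_sub, h1])]
      exact Submodule.zero_mem _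

theorem iSup_summand (H : IsLadder n G L R) (m : ℕ) (hm : m ≤ n) :
    ⨆ k : Fin (min (n - m) m + 1), summand G L R m k = G m :=
  le_antisymm (iSup_le fun k => H.summand_le (by have := k.2; omega)) (H.le_iSup_summand m hm)

theorem pow_injOn_primitive (H : IsLadder n G L R) {k q : ℕ} (hq : 2 * k + q ≤ n) {x : U}
    (hx : x ∈ primitive G L k) (h : (R ^ q) x = 0) : x = 0 := by
  induction q with
  | zero => simpa using h
  | succ q ih =>
    apply ih (by omega)
    have h1 := H.lower_pow_primitive hx q
    rw [h, map_zero] at h1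
    refine (smul_eq_zero.mp h1.symm).resolve_left (mul_ne_zero (by positivity) ?_)
    have : (n : ℂ) - 2 * k - q = ((n - 2 * k - q : ℕ) : ℂ) := by
      rw [Nat.cast_sub (by omega), Nat.cast_sub (by omega)]; push_cast; ring
    rw [this, Nat.cast_ne_zero]
    omega

end IsLadder

/-! ### Monomials and coefficients in `Pol ⊗ Pol` -/

/-- The exponent of `x^p y^q`. -/
def expo (p q : ℕ) : Fin 2 →₀ ℕ := Finsupp.single 0 p + Finsupp.single 1 q

@[simp] theorem expo_zero (p q : ℕ) : expo p q 0 = p := by simp [expo]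

@[simp] theorem expo_one (p q : ℕ) : expo p q 1 = q := by simp [expo]

theorem expo_eta (e : Fin 2 →₀ ℕ) : expo (e 0) (e 1) = e := by
  ext i
  fin_cases i <;> simp

theorem expo_inj {p q p' q' : ℕ} : expo p q = expo p' q' ↔ p = p' ∧ q = q' := by
  constructor
  · intro h
    have h0 := DFunLike.congr_fun h 0
    have h1 := DFunLike.congr_fun h 1
    simp only [expo_zero, expo_one] at h0 h1
    exact ⟨h0, h1⟩
  · rintro ⟨rfl, rfl⟩
    rfl

theorem mono_eq_monomial (p q : ℕ) : mono p q = MvPolynomial.monomial (expo p q) (1 : ℂ) :=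
  mono_eq p q

theorem X0_mul_mono (p q : ℕ) : MvPolynomial.X 0 * mono p q = mono (p + 1) q := by
  rw [mono, mono]; ring

theorem X1_mul_mono (p q : ℕ) : MvPolynomial.X 1 * mono p q = mono p (q + 1) := by
  rw [mono, mono]; ring

theorem mono_mul_mono (p q r s : ℕ) : mono p q * mono r s = mono (p + r) (q + s) := by
  rw [mono, mono, mono]; ring

theorem pderiv_zero_mono (p q : ℕ) :
    MvPolynomial.pderiv (0 : Fin 2) (mono p q) = (p : ℂ) • mono (p - 1) q := by
  rw [mono_eq_monomial, MvPolynomial.pderiv_monomial, mono_eq_monomial, MvPolynomial.smul_monomial]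
  have h : expo p q - Finsupp.single 0 1 = expo (p - 1) q := by ext i; fin_cases i <;> simp
  rw [h, expo_zero, one_mul, smul_eq_mul, mul_one]

theorem pderiv_one_mono (p q : ℕ) :
    MvPolynomial.pderiv (1 : Fin 2) (mono p q) = (q : ℂ) • mono p (q - 1) := by
  rw [mono_eq_monomial, MvPolynomial.pderiv_monomial, mono_eq_monomial, MvPolynomial.smul_monomial]
  have h : expo p q - Finsupp.single 1 1 = expo p (q - 1) := by ext i; fin_cases i <;> simp
  rw [h, expo_one, one_mul, smul_eq_mul, mul_one]

theorem coeff_mono (p q p' q' : ℕ) :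
    MvPolynomial.coeff (expo p q) (mono p' q') = if p = p' ∧ q = q' then (1 : ℂ) else 0 := by
  simp only [mono_eq_monomial, MvPolynomial.coeff_monomial, expo_inj, eq_comm]

/-- The monomial `x₁^a y₁^b x₂^c y₂^d`. -/
def bimono (a b c d : ℕ) : Pol2 := mono a b ⊗ₜ[ℂ] mono c d

/-- The coefficient of `x₁^a y₁^b x₂^c y₂^d`. -/
def bicoeff (a b c d : ℕ) : Pol2 →ₗ[ℂ] ℂ :=
  LinearMap.mul' ℂ ℂ ∘ₗ
    TensorProduct.map (MvPolynomial.lcoeff ℂ (expo a b)) (MvPolynomial.lcoeff ℂ (expo c d))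

theorem bicoeff_tmul (a b c d : ℕ) (P Q : Pol) :
    bicoeff a b c d (P ⊗ₜ[ℂ] Q) = P.coeff (expo a b) * Q.coeff (expo c d) := rfl

theorem bicoeff_bimono (a b c d a' b' c' d' : ℕ) :
    bicoeff a b c d (bimono a' b' c' d')
      = if (a = a' ∧ b = b') ∧ c = c' ∧ d = d' then 1 else 0 := by
  rw [bimono, bicoeff_tmul, coeff_mono, coeff_mono]
  split_ifs <;> simp_all

/-- The monomial basis of `Pol ⊗ Pol`. -/
def bibasis : Module.Basis ((Fin 2 →₀ ℕ) × (Fin 2 →₀ ℕ)) ℂ Pol2 :=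
  (MvPolynomial.basisMonomials (Fin 2) ℂ).tensorProduct (MvPolynomial.basisMonomials (Fin 2) ℂ)

theorem bibasis_apply (e : (Fin 2 →₀ ℕ) × (Fin 2 →₀ ℕ)) :
    bibasis e = bimono (e.1 0) (e.1 1) (e.2 0) (e.2 1) := by
  rw [bibasis, Module.Basis.tensorProduct_apply', bimono, mono_eq_monomial, mono_eq_monomial,
    expo_eta, expo_eta, MvPolynomial.coe_basisMonomials]

theorem linearMap_ext_bimono {N : Type*} [AddCommMonoid N] [Module ℂ N] {f g : Pol2 →ₗ[ℂ] N}
    (h : ∀ a b c d, f (bimono a b c d) = g (bimono a b c d)) : f = g :=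
  bibasis.ext fun e => by rw [bibasis_apply, h]

theorem eq_zero_of_bicoeff {f : Pol2} (h : ∀ a b c d, bicoeff a b c d f = 0) : f = 0 := by
  apply bibasis.repr.injective
  ext e
  have : (Finsupp.lapply e ∘ₗ bibasis.repr.toLinearMap : Pol2 →ₗ[ℂ] ℂ)
      = bicoeff (e.1 0) (e.1 1) (e.2 0) (e.2 1) := by
    refine bibasis.ext fun e' => ?_
    rw [LinearMap.comp_apply, LinearEquiv.coe_coe, Module.Basis.repr_self, bibasis_apply,
      bicoeff_bimono, Finsupp.lapply_apply, Finsupp.single_apply]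
    congr 1
    rw [← expo_inj, ← expo_inj, expo_eta, expo_eta, expo_eta, expo_eta, Prod.ext_iff,
      eq_comm (a := e'.1), eq_comm (a := e'.2)]
  have h2 := LinearMap.congr_fun this f
  rw [h] at h2
  simpa using h2

theorem V_eq_span (d : ℕ) :
    V d = Submodule.span ℂ {P | ∃ p q, p + q = d ∧ P = mono p q} := by
  apply le_antisymm
  · intro P hP
    rw [P.as_sum]
    refine Submodule.sum_mem _ fun e he => ?_
    rw [← mul_one (P.coeff e), ← smul_eq_mul, ← MvPolynomial.smul_monomial]
    refine Submodule.smul_mem _ _ (Submodule.subset_span ⟨e 0, e 1, ?_, ?_⟩)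
    · have := (MvPolynomial.mem_homogeneousSubmodule d P).mp hP
        (MvPolynomial.mem_support_iff.mp he)
      rw [← this, Finsupp.weight_apply, Finsupp.sum_fintype _ _ (by simp), Fin.sum_univ_two]
      simp
    · rw [mono_eq_monomial, expo_eta]
  · rw [Submodule.span_le]
    rintro _ ⟨p, q, rfl, rfl⟩
    have := mono_mem_V (Nat.le_add_left q p)
    rwa [Nat.add_sub_cancel] at this

theorem tens_eq_span (p q : ℕ) :
    tens p q = Submodule.span ℂ
      {f | ∃ a b c d, a + b = p ∧ c + d = q ∧ f = bimono a b c d} := by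
  rw [tens, TensorProduct.range_mapIncl, V_eq_span, V_eq_span, Submodule.map₂_span_span]
  congr 1
  ext f
  constructor
  · rintro ⟨_, ⟨a, b, h, rfl⟩, _, ⟨c, d, h', rfl⟩, rfl⟩
    exact ⟨a, b, c, d, h, h', rfl⟩
  · rintro ⟨a, b, c, d, h, h', rfl⟩
    exact ⟨_, ⟨a, b, h, rfl⟩, _, ⟨c, d, h', rfl⟩, rfl⟩

theorem bimono_mem_tens {p q a b c d : ℕ} (h : a + b = p) (h' : c + d = q) :
    bimono a b c d ∈ tens p q := by
  rw [tens_eq_span]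
  exact Submodule.subset_span ⟨a, b, c, d, h, h', rfl⟩

theorem bicoeff_eq_zero {p q : ℕ} {f : Pol2} (hf : f ∈ tens p q) {a b c d : ℕ}
    (h : ¬(a + b = p ∧ c + d = q)) : bicoeff a b c d f = 0 := by
  rw [tens_eq_span] at hf
  induction hf using Submodule.span_induction with
  | mem x hx =>
    obtain ⟨a', b', c', d', h1, h2, rfl⟩ := hx
    rw [bicoeff_bimono, if_neg]
    rintro ⟨⟨rfl, rfl⟩, rfl, rfl⟩
    exact h ⟨h1, h2⟩
  | zero => simp
  | add x y _ _ hx hy => rw [map_add, hx, hy, add_zero]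
  | smul r x _ hx => rw [map_smul, hx, smul_zero]

/-! ### The polarization operators on monomials -/

theorem polarLower_bimono (a b c d : ℕ) :
    polarLower (bimono a b c d)
      = (c : ℂ) • bimono (a + 1) b (c - 1) d + (d : ℂ) • bimono a (b + 1) c (d - 1) := by
  simp only [polarLower, bimono, Fin.sum_univ_two, LinearMap.add_apply, TensorProduct.map_tmul,
    LinearMap.mulLeft_apply, Derivation.coeFn_coe, X0_mul_mono, X1_mul_mono, pderiv_zero_mono,
    pderiv_one_mono, TensorProduct.tmul_smul]

theorem polarRaise_bimono (a b c d : ℕ) :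
    polarRaise (bimono a b c d)
      = (a : ℂ) • bimono (a - 1) b (c + 1) d + (b : ℂ) • bimono a (b - 1) c (d + 1) := by
  simp only [polarRaise, bimono, Fin.sum_univ_two, LinearMap.add_apply, TensorProduct.map_tmul,
    LinearMap.mulLeft_apply, Derivation.coeFn_coe, X0_mul_mono, X1_mul_mono, pderiv_zero_mono,
    pderiv_one_mono, TensorProduct.smul_tmul']

theorem polarLower_polarRaise_bimono (a b c d : ℕ) :
    polarLower (polarRaise (bimono a b c d)) = polarRaise (polarLower (bimono a b c d))
      + ((a : ℂ) + b - c - d) • bimono a b c d := by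
  rw [polarRaise_bimono, polarLower_bimono]
  simp only [map_add, map_smul, polarRaise_bimono, polarLower_bimono]
  -- A truncated predecessor of a zero exponent always comes with the coefficient zero; the case
  -- split makes this visible.
  rcases a with _ | a <;> rcases b with _ | b <;> rcases c with _ | c <;> rcases d with _ | d <;>
    simp only [Nat.add_sub_cancel, Nat.cast_zero, zero_smul, Nat.cast_add, Nat.cast_one] <;>
    module

theorem polarLower_mem_tens {p q : ℕ} {f : Pol2} (hf : f ∈ tens p (q + 1)) :
    polarLower f ∈ tens (p + 1) q := by
  have : tens p (q + 1) ≤ (tens (p + 1) q).comap polarLower := by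
    rw [tens_eq_span, Submodule.span_le]
    rintro _ ⟨a, b, c, d, h1, h2, rfl⟩
    rw [SetLike.mem_coe, Submodule.mem_comap, polarLower_bimono]
    refine Submodule.add_mem _ ?_ ?_
    · rcases c with _ | c
      · simp
      · exact Submodule.smul_mem _ _ (bimono_mem_tens (by omega) (by omega))
    · rcases d with _ | d
      · simp
      · exact Submodule.smul_mem _ _ (bimono_mem_tens (by omega) (by omega))
  exact this hf

theorem polarLower_eq_zero {p : ℕ} {f : Pol2} (hf : f ∈ tens p 0) : polarLower f = 0 := by
  have : tens p 0 ≤ LinearMap.ker polarLower := by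
    rw [tens_eq_span, Submodule.span_le]
    rintro _ ⟨a, b, c, d, h1, h2, rfl⟩
    obtain ⟨rfl, rfl⟩ : c = 0 ∧ d = 0 := by omega
    simp [polarLower_bimono]
  exact this hf

theorem polarRaise_mem_tens {p q : ℕ} {f : Pol2} (hf : f ∈ tens (p + 1) q) :
    polarRaise f ∈ tens p (q + 1) := by
  have : tens (p + 1) q ≤ (tens p (q + 1)).comap polarRaise := by
    rw [tens_eq_span, Submodule.span_le]
    rintro _ ⟨a, b, c, d, h1, h2, rfl⟩
    rw [SetLike.mem_coe, Submodule.mem_comap, polarRaise_bimono]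
    refine Submodule.add_mem _ ?_ ?_
    · rcases a with _ | a
      · simp
      · exact Submodule.smul_mem _ _ (bimono_mem_tens (by omega) (by omega))
    · rcases b with _ | b
      · simp
      · exact Submodule.smul_mem _ _ (bimono_mem_tens (by omega) (by omega))
  exact this hf

theorem polarRaise_eq_zero {q : ℕ} {f : Pol2} (hf : f ∈ tens 0 q) : polarRaise f = 0 := by
  have : tens 0 q ≤ LinearMap.ker polarRaise := by
    rw [tens_eq_span, Submodule.span_le]
    rintro _ ⟨a, b, c, d, h1, h2, rfl⟩
    obtain ⟨rfl, rfl⟩ : a = 0 ∧ b = 0 := by omega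
    simp [polarRaise_bimono]
  exact this hf

theorem polarLower_polarRaise {p q : ℕ} {f : Pol2} (hf : f ∈ tens p q) :
    polarLower (polarRaise f) = polarRaise (polarLower f) + ((p : ℂ) - q) • f := by
  have : tens p q ≤ LinearMap.eqLocus (polarLower ∘ₗ polarRaise)
      (polarRaise ∘ₗ polarLower + ((p : ℂ) - q) • LinearMap.id) := by
    rw [tens_eq_span, Submodule.span_le]
    rintro _ ⟨a, b, c, d, rfl, rfl, rfl⟩
    rw [SetLike.mem_coe, LinearMap.mem_eqLocus, LinearMap.comp_apply,
      polarLower_polarRaise_bimono]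
    simp only [LinearMap.add_apply, LinearMap.comp_apply, LinearMap.smul_apply, LinearMap.id_apply]
    push_cast
    congr 2
    ring
  exact this hf

/-- The spaces `V_{(n-m)/2} ⊗ V_{m/2}` for `0 ≤ m ≤ n`. -/
def tensGrade (n m : ℕ) : Submodule ℂ Pol2 := if m ≤ n then tens (n - m) m else ⊥

theorem tensGrade_of_le {n m : ℕ} (h : m ≤ n) : tensGrade n m = tens (n - m) m := if_pos h

/-- The commutator in bidegree `(p, q)` is `p - q`, which is `n - 2m` for `(n-m, m)`. The cut-off
above `n` is consistent because `D*` kills the polynomials free of `x₁, y₁`. -/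
theorem isLadder_tensGrade (n : ℕ) : IsLadder n (tensGrade n) polarLower polarRaise where
  lower m f hf := by
    by_cases h : m + 1 ≤ n
    · rw [tensGrade_of_le h] at hf
      rw [tensGrade_of_le (by omega), show n - m = n - (m + 1) + 1 by omega]
      exact polarLower_mem_tens hf
    · rw [tensGrade, if_neg h, Submodule.mem_bot] at hf
      rw [hf, map_zero]
      exact Submodule.zero_mem _
  lower_zero f hf := by
    rw [tensGrade_of_le (Nat.zero_le n)] at hf
    exact polarLower_eq_zero hf
  raise m f hf := by
    rcases lt_trichotomy m n with h | rfl | h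
    · rw [tensGrade_of_le h.le, show n - m = n - (m + 1) + 1 by omega] at hf
      rw [tensGrade_of_le (by omega)]
      exact polarRaise_mem_tens hf
    · rw [tensGrade_of_le le_rfl, Nat.sub_self] at hf
      rw [polarRaise_eq_zero hf]
      exact Submodule.zero_mem _
    · rw [tensGrade, if_neg (by omega), Submodule.mem_bot] at hf
      rw [hf, map_zero]
      exact Submodule.zero_mem _
  vanish m hm f hf := by
    rwa [tensGrade, if_neg (by omega), Submodule.mem_bot] at hf
  comm m f hf := by
    by_cases h : m ≤ n
    · rw [tensGrade_of_le h] at hf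
      rw [polarLower_polarRaise hf, Nat.cast_sub h]
      congr 2
      ring
    · rw [tensGrade, if_neg h, Submodule.mem_bot] at hf
      simp [hf]

theorem primitive_tensGrade {n k : ℕ} (hk : k ≤ n) :
    IsLadder.primitive (tensGrade n) polarLower k = polarKer n k := by
  rw [IsLadder.primitive, tensGrade_of_le hk, polarKer]

theorem summand_tensGrade {n m k : ℕ} (hk : k ≤ n) :
    IsLadder.summand (tensGrade n) polarLower polarRaise m k = cgSummand n m k := by
  rw [IsLadder.summand, primitive_tensGrade hk, cgSummand]

/-! ### The total degree in `x₁`, `x₂` -/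

/-- The Euler operator `x₁ ∂/∂x₁ + x₂ ∂/∂x₂`. -/
def eulerX : Module.End ℂ Pol2 :=
  TensorProduct.map (LinearMap.mulLeft ℂ (MvPolynomial.X 0 : Pol) ∘ₗ
      (MvPolynomial.pderiv 0 : Derivation ℂ Pol Pol).toLinearMap) LinearMap.id
    + TensorProduct.map LinearMap.id (LinearMap.mulLeft ℂ (MvPolynomial.X 0 : Pol) ∘ₗ
      (MvPolynomial.pderiv 0 : Derivation ℂ Pol Pol).toLinearMap)

theorem eulerX_bimono (a b c d : ℕ) :
    eulerX (bimono a b c d) = ((a + c : ℕ) : ℂ) • bimono a b c d := by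
  simp only [eulerX, bimono, LinearMap.add_apply, TensorProduct.map_tmul, LinearMap.comp_apply,
    LinearMap.mulLeft_apply, Derivation.coeFn_coe, pderiv_zero_mono, LinearMap.id_apply,
    mul_smul_comm, X0_mul_mono, Nat.cast_add, add_smul, TensorProduct.tmul_smul,
    ← TensorProduct.smul_tmul']
  congr 1
  · rcases a with _ | a <;> simp
  · rcases c with _ | c <;> simp

/-- The elements of `Pol ⊗ Pol` of total degree `h` in `x₁`, `x₂`. -/
def weightSpace (h : ℕ) : Submodule ℂ Pol2 := Module.End.eigenspace eulerX (h : ℂ)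

theorem iSupIndep_weightSpace : iSupIndep weightSpace :=
  (Module.End.eigenspaces_iSupIndep eulerX).comp Nat.cast_injective

theorem bicoeff_eulerX (a b c d : ℕ) (f : Pol2) :
    bicoeff a b c d (eulerX f) = ((a + c : ℕ) : ℂ) * bicoeff a b c d f := by
  have : bicoeff a b c d ∘ₗ eulerX = ((a + c : ℕ) : ℂ) • bicoeff a b c d := by
    refine linearMap_ext_bimono fun a' b' c' d' => ?_
    rw [LinearMap.comp_apply, eulerX_bimono, map_smul, LinearMap.smul_apply, bicoeff_bimono]
    split_ifs with h
    · obtain ⟨⟨rfl, rfl⟩, rfl, rfl⟩ := h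
      rfl
    · simp
  exact LinearMap.congr_fun this f

theorem bicoeff_eq_zero_of_weight {h : ℕ} {f : Pol2} (hf : f ∈ weightSpace h) {a b c d : ℕ}
    (hne : a + c ≠ h) : bicoeff a b c d f = 0 := by
  have h1 := bicoeff_eulerX a b c d f
  rw [Module.End.mem_eigenspace_iff.mp hf, map_smul, smul_eq_mul] at h1
  have h2 : (((a + c : ℕ) : ℂ) - h) * bicoeff a b c d f = 0 := by rw [sub_mul, h1, sub_self]
  refine (mul_eq_zero.mp h2).resolve_left (sub_ne_zero.mpr ?_)
  exact_mod_cast hne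

/-- The coefficients of the image under the lowering polarization. -/
theorem bicoeff_polarLower (a b c d : ℕ) (f : Pol2) :
    bicoeff a b c d (polarLower f)
      = (if a = 0 then 0 else ((c : ℂ) + 1) * bicoeff (a - 1) b (c + 1) d f)
        + (if b = 0 then 0 else ((d : ℂ) + 1) * bicoeff a (b - 1) c (d + 1) f) := by
  have : bicoeff a b c d ∘ₗ polarLower
      = (if a = 0 then 0 else ((c : ℂ) + 1) • bicoeff (a - 1) b (c + 1) d)
        + (if b = 0 then 0 else ((d : ℂ) + 1) • bicoeff a (b - 1) c (d + 1)) := by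
    refine linearMap_ext_bimono fun a' b' c' d' => ?_
    rw [LinearMap.comp_apply, polarLower_bimono, map_add, map_smul, map_smul, LinearMap.add_apply]
    congr 1
    · rcases a with _ | a <;> rcases c' with _ | c' <;>
        simp [bicoeff_bimono]
      split_ifs with h
      · rw [h.2.1]
      · rfl
    · rcases b with _ | b <;> rcases d' with _ | d' <;>
        simp [bicoeff_bimono]
      split_ifs with h
      · rw [h.2.2]
      · rfl
  have h := LinearMap.congr_fun this f
  rw [LinearMap.comp_apply, LinearMap.add_apply] at h
  rw [h]
  split_ifs <;> rfl

/-! ### The Johnson scheme -/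

theorem dirac_ext {n : ℕ} {N : Type*} [AddCommMonoid N] [Module ℂ N]
    {f g : SubsetFun n →ₗ[ℂ] N} (h : ∀ X, f (dirac X) = g (dirac X)) : f = g :=
  (Pi.basisFun ℂ (Finset (Fin n))).ext fun X => by rw [Pi.basisFun_apply]; exact h X

theorem radonD_dirac {n : ℕ} (X : Finset (Fin n)) :
    radonD n (dirac X) = ∑ x ∈ X, dirac (X.erase x) := by
  rw [radonD, dirac, Fintype.linearCombination_apply_single, one_smul]

theorem radonDStar_dirac {n : ℕ} (X : Finset (Fin n)) :
    radonDStar n (dirac X) = ∑ x ∈ Xᶜ, dirac (insert x X) := by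
  rw [radonDStar, dirac, Fintype.linearCombination_apply_single, one_smul]

theorem schurWeyl_dirac {n : ℕ} (h : ℕ) (X : Finset (Fin n)) :
    schurWeyl n h (dirac X)
      = bimono (Xᶜ ∩ setA n h).card (Xᶜ ∩ (setA n h)ᶜ).card
        (X ∩ setA n h).card (X ∩ (setA n h)ᶜ).card := by
  rw [schurWeyl, dirac, Fintype.linearCombination_apply_single, one_smul, bimono]

theorem johnsonM_eq_span (n m : ℕ) :
    johnsonM n m = Submodule.span ℂ {f | ∃ X : Finset (Fin n), X.card = m ∧ f = dirac X} := by
  apply le_antisymm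
  · intro f hf
    rw [pi_eq_sum_univ' f]
    refine Submodule.sum_mem _ fun X _ => ?_
    by_cases hX : X.card = m
    · refine Submodule.smul_mem _ _ (Submodule.subset_span ⟨X, hX, ?_⟩)
      ext Y
      simp [dirac, Pi.single_apply]
    · rw [hf X hX, zero_smul]
      exact Submodule.zero_mem _
  · rw [Submodule.span_le]
    rintro _ ⟨X, hX, rfl⟩ Y hY
    rw [dirac, Pi.single_eq_of_ne]
    rintro rfl
    exact hY hX

theorem dirac_mem_johnsonM {n m : ℕ} {X : Finset (Fin n)} (h : X.card = m) :
    dirac X ∈ johnsonM n m := by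
  rw [johnsonM_eq_span]
  exact Submodule.subset_span ⟨X, h, rfl⟩

/-- Both products contain the same sum over exchanges of an element of `X` with one outside `X`.
They differ only in how often `X` itself returns: `n - |X|` times against `|X|` times. -/
theorem radonD_radonDStar_dirac {n : ℕ} (X : Finset (Fin n)) :
    radonD n (radonDStar n (dirac X))
      = radonDStar n (radonD n (dirac X)) + ((n : ℂ) - 2 * X.card) • dirac X := by
  have h1 : radonD n (radonDStar n (dirac X))
      = ((n : ℂ) - X.card) • dirac X + ∑ x ∈ Xᶜ, ∑ y ∈ X, dirac (insert x (X.erase y)) := by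
    rw [radonDStar_dirac, map_sum]
    have : ∀ x ∈ Xᶜ, radonD n (dirac (insert x X))
        = dirac X + ∑ y ∈ X, dirac (insert x (X.erase y)) := by
      intro x hx
      rw [Finset.mem_compl] at hx
      rw [radonD_dirac, Finset.sum_insert hx, Finset.erase_insert hx]
      congr 1
      refine Finset.sum_congr rfl fun y hy => ?_
      rw [Finset.erase_insert_of_ne]
      rintro rfl
      exact hx hy
    rw [Finset.sum_congr rfl this, Finset.sum_add_distrib, Finset.sum_const, Finset.card_compl,
      Fintype.card_fin, ← Nat.cast_smul_eq_nsmul ℂ, Nat.cast_sub (by simpa using X.card_le_univ)]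
  have h2 : radonDStar n (radonD n (dirac X))
      = (X.card : ℂ) • dirac X + ∑ x ∈ Xᶜ, ∑ y ∈ X, dirac (insert x (X.erase y)) := by
    rw [radonD_dirac, map_sum]
    have : ∀ y ∈ X, radonDStar n (dirac (X.erase y))
        = dirac X + ∑ x ∈ Xᶜ, dirac (insert x (X.erase y)) := by
      intro y hy
      rw [radonDStar_dirac, Finset.compl_erase, Finset.sum_insert (by simpa using hy),
        Finset.insert_erase hy]
    rw [Finset.sum_congr rfl this, Finset.sum_add_distrib, Finset.sum_const,
      ← Nat.cast_smul_eq_nsmul ℂ, Finset.sum_comm]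
  rw [h1, h2]
  module

theorem isLadder_johnsonM (n : ℕ) : IsLadder n (johnsonM n) (radonD n) (radonDStar n) where
  lower m f hf := by
    have : johnsonM n (m + 1) ≤ (johnsonM n m).comap (radonD n) := by
      rw [johnsonM_eq_span n (m + 1), Submodule.span_le]
      rintro _ ⟨X, hX, rfl⟩
      rw [SetLike.mem_coe, Submodule.mem_comap, radonD_dirac]
      refine Submodule.sum_mem _ fun x hx => dirac_mem_johnsonM ?_
      rw [Finset.card_erase_of_mem hx, hX, Nat.add_sub_cancel]
    exact this hf
  lower_zero f hf := by
    have : johnsonM n 0 ≤ LinearMap.ker (radonD n) := by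
      rw [johnsonM_eq_span, Submodule.span_le]
      rintro _ ⟨X, hX, rfl⟩
      rw [SetLike.mem_coe, LinearMap.mem_ker, radonD_dirac, Finset.card_eq_zero.mp hX,
        Finset.sum_empty]
    exact this hf
  raise m f hf := by
    have : johnsonM n m ≤ (johnsonM n (m + 1)).comap (radonDStar n) := by
      rw [johnsonM_eq_span n m, Submodule.span_le]
      rintro _ ⟨X, hX, rfl⟩
      rw [SetLike.mem_coe, Submodule.mem_comap, radonDStar_dirac]
      refine Submodule.sum_mem _ fun x hx => dirac_mem_johnsonM ?_
      rw [Finset.card_insert_of_notMem (Finset.mem_compl.mp hx), hX]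
    exact this hf
  vanish m hm f hf := by
    ext X
    refine hf X ?_
    have := X.card_le_univ
    rw [Fintype.card_fin] at this
    omega
  comm m f hf := by
    have : johnsonM n m ≤ LinearMap.eqLocus (radonD n ∘ₗ radonDStar n)
        (radonDStar n ∘ₗ radonD n + ((n : ℂ) - 2 * m) • LinearMap.id) := by
      rw [johnsonM_eq_span, Submodule.span_le]
      rintro _ ⟨X, rfl, rfl⟩
      rw [SetLike.mem_coe, LinearMap.mem_eqLocus]
      exact radonD_radonDStar_dirac X
    exact this hf

theorem summand_johnsonM {n m k : ℕ} :
    IsLadder.summand (johnsonM n) (radonD n) (radonDStar n) m k = johnsonSummand n m k := by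
  rw [johnsonSummand, radonR, Submodule.map_smul _ _ _
    (inv_ne_zero (Nat.cast_ne_zero.mpr (Nat.factorial_ne_zero _)))]
  rfl

/-! ### The Schur--Weyl map -/

theorem sum_split {n : ℕ} {N : Type*} [AddCommMonoid N] (X A : Finset (Fin n)) (u : Fin n → N)
    {p q : N} (hp : ∀ x ∈ X, x ∈ A → u x = p) (hq : ∀ x ∈ X, x ∉ A → u x = q) :
    ∑ x ∈ X, u x = (X ∩ A).card • p + (X ∩ Aᶜ).card • q := by
  have : ∀ x ∈ X, u x = if x ∈ A then p else q := by
    intro x hx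
    split_ifs with h
    exacts [hp x hx h, hq x hx h]
  rw [Finset.sum_congr rfl this, Finset.sum_ite, Finset.sum_const, Finset.sum_const,
    Finset.filter_mem_eq_inter, Finset.filter_notMem_eq_sdiff, Finset.sdiff_eq_inter_compl]

/-- Removing an element of `X ∩ A` turns a factor `x₂` into `x₁`, and removing one of `X ∩ B` turns
`y₂` into `y₁`. The number of choices is the exponent that the derivative brings down. -/
theorem schurWeyl_radonD {n : ℕ} (h : ℕ) (f : SubsetFun n) :
    schurWeyl n h (radonD n f) = polarLower (schurWeyl n h f) := by
  have : schurWeyl n h ∘ₗ radonD n = polarLower ∘ₗ schurWeyl n h := by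
    refine dirac_ext fun X => ?_
    rw [LinearMap.comp_apply, LinearMap.comp_apply, radonD_dirac, map_sum, schurWeyl_dirac,
      polarLower_bimono, Nat.cast_smul_eq_nsmul, Nat.cast_smul_eq_nsmul]
    refine sum_split X (setA n h) _ (fun x hx hA => ?_) (fun x hx hA => ?_)
    · rw [schurWeyl_dirac, Finset.compl_erase, Finset.insert_inter_of_mem hA,
        Finset.insert_inter_of_notMem (by simpa using hA), Finset.erase_inter,
        Finset.erase_inter, Finset.card_insert_of_notMem (by simp [hx]),
        Finset.card_erase_of_mem (by simp [hx, hA]), Finset.erase_eq_of_notMem (s := X ∩ _)]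
      simp [hA]
    · rw [schurWeyl_dirac, Finset.compl_erase, Finset.insert_inter_of_mem (s₂ := (setA n h)ᶜ)
        (by simpa using hA), Finset.insert_inter_of_notMem hA, Finset.erase_inter,
        Finset.erase_inter, Finset.card_insert_of_notMem (by simp [hx]),
        Finset.card_erase_of_mem (s := X ∩ (setA n h)ᶜ) (by simp [hx, hA]),
        Finset.erase_eq_of_notMem (s := X ∩ setA n h)]
      simp [hA]
  exact LinearMap.congr_fun this f

theorem schurWeyl_radonDStar {n : ℕ} (h : ℕ) (f : SubsetFun n) :
    schurWeyl n h (radonDStar n f) = polarRaise (schurWeyl n h f) := by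
  have : schurWeyl n h ∘ₗ radonDStar n = polarRaise ∘ₗ schurWeyl n h := by
    refine dirac_ext fun X => ?_
    rw [LinearMap.comp_apply, LinearMap.comp_apply, radonDStar_dirac, map_sum, schurWeyl_dirac,
      polarRaise_bimono, Nat.cast_smul_eq_nsmul, Nat.cast_smul_eq_nsmul]
    refine sum_split Xᶜ (setA n h) _ (fun x hx hA => ?_) (fun x hx hA => ?_)
    · have hx' : x ∉ X := by simpa using hx
      rw [schurWeyl_dirac, Finset.compl_insert, Finset.insert_inter_of_mem hA,
        Finset.insert_inter_of_notMem (by simpa using hA), Finset.erase_inter,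
        Finset.erase_inter, Finset.card_insert_of_notMem (by simp [hx']),
        Finset.card_erase_of_mem (by simp [hx', hA]), Finset.erase_eq_of_notMem (s := Xᶜ ∩ _)]
      simp [hA]
    · have hx' : x ∉ X := by simpa using hx
      rw [schurWeyl_dirac, Finset.compl_insert, Finset.insert_inter_of_mem (s₂ := (setA n h)ᶜ)
        (by simpa using hA), Finset.insert_inter_of_notMem hA, Finset.erase_inter,
        Finset.erase_inter, Finset.card_insert_of_notMem (by simp [hx']),
        Finset.card_erase_of_mem (s := Xᶜ ∩ (setA n h)ᶜ) (by simp [hx', hA]),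
        Finset.erase_eq_of_notMem (s := Xᶜ ∩ setA n h)]
      simp [hA]
  exact LinearMap.congr_fun this f

theorem schurWeyl_radonDStar_pow {n : ℕ} (h q : ℕ) (f : SubsetFun n) :
    schurWeyl n h ((radonDStar n ^ q) f) = (polarRaise ^ q) (schurWeyl n h f) := by
  induction q with
  | zero => simp
  | succ q ih =>
    rw [pow_succ', pow_succ', Module.End.mul_apply, Module.End.mul_apply, schurWeyl_radonDStar, ih]

theorem card_inter_add_card_inter_compl {n : ℕ} (X A : Finset (Fin n)) :
    (X ∩ A).card + (X ∩ Aᶜ).card = X.card := by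
  rw [← Finset.sdiff_eq_inter_compl, Finset.card_inter_add_card_sdiff]

theorem card_compl_inter_add {n : ℕ} (X A : Finset (Fin n)) :
    (Xᶜ ∩ A).card + (X ∩ A).card = A.card := by
  rw [Finset.inter_comm, Finset.inter_comm X, add_comm, card_inter_add_card_inter_compl]

theorem card_setA {n h : ℕ} (hh : h ≤ n) : (setA n h).card = h := by
  rw [setA, Fin.card_filter_val_lt, min_eq_right hh]

theorem card_compl_setA {n h : ℕ} (hh : h ≤ n) : ((setA n h)ᶜ).card = n - h := by
  rw [Finset.card_compl, card_setA hh, Fintype.card_fin]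

theorem schurWeyl_mem_tens {n m : ℕ} (h : ℕ) {f : SubsetFun n} (hf : f ∈ johnsonM n m) :
    schurWeyl n h f ∈ tens (n - m) m := by
  have : johnsonM n m ≤ (tens (n - m) m).comap (schurWeyl n h) := by
    rw [johnsonM_eq_span, Submodule.span_le]
    rintro _ ⟨X, rfl, rfl⟩
    rw [SetLike.mem_coe, Submodule.mem_comap, schurWeyl_dirac]
    refine bimono_mem_tens ?_ (card_inter_add_card_inter_compl _ _)
    rw [card_inter_add_card_inter_compl, Finset.card_compl, Fintype.card_fin]
  exact this hf

/-- The exponents of `x₁` and `x₂` count `A \ X` and `A ∩ X`, so they add up to `|A| = h`. -/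
theorem schurWeyl_mem_weightSpace {n h : ℕ} (hh : h ≤ n) (f : SubsetFun n) :
    schurWeyl n h f ∈ weightSpace h := by
  rw [weightSpace, Module.End.mem_eigenspace_iff]
  have : eulerX ∘ₗ schurWeyl n h = (h : ℂ) • schurWeyl n h := by
    refine dirac_ext fun X => ?_
    rw [LinearMap.comp_apply, LinearMap.smul_apply, schurWeyl_dirac, eulerX_bimono,
      card_compl_inter_add, card_setA hh]
  exact LinearMap.congr_fun this f

theorem schurWeyl_specht_le {n h k : ℕ} :
    (specht n k).map (schurWeyl n h) ≤ polarKer n k := by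
  rintro _ ⟨f, hf, rfl⟩
  refine ⟨schurWeyl_mem_tens h hf.1, LinearMap.mem_ker.mpr ?_⟩
  rw [← schurWeyl_radonD, LinearMap.mem_ker.mp hf.2, map_zero]

theorem schurWeyl_johnsonSummand (n m k h : ℕ) :
    (johnsonSummand n m k).map (schurWeyl n h)
      = ((specht n k).map (schurWeyl n h)).map (polarRaise ^ (m - k)) := by
  rw [← summand_johnsonM, IsLadder.summand]
  ext f
  simp only [Submodule.mem_map, exists_exists_and_eq_and, schurWeyl_radonDStar_pow]
  rfl

theorem radonD_apply {n : ℕ} (f : SubsetFun n) (Y : Finset (Fin n)) :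
    radonD n f Y = ∑ x ∈ Yᶜ, f (insert x Y) := by
  have : LinearMap.proj Y ∘ₗ radonD n
      = ∑ x ∈ Yᶜ, (LinearMap.proj (insert x Y) : SubsetFun n →ₗ[ℂ] ℂ) := by
    refine dirac_ext fun X => ?_
    rw [LinearMap.comp_apply, radonD_dirac]
    simp only [LinearMap.sum_apply, LinearMap.proj_apply, Finset.sum_apply, dirac, Pi.single_apply]
    rw [← Finset.sum_filter, ← Finset.sum_filter, Finset.sum_const, Finset.sum_const]
    congr 2
    ext x
    simp only [Finset.mem_filter, Finset.mem_compl]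
    constructor
    · rintro ⟨h, rfl⟩
      exact ⟨Finset.notMem_erase x X, Finset.insert_erase h⟩
    · rintro ⟨h, rfl⟩
      exact ⟨Finset.mem_insert_self x Y, (Finset.erase_insert h).symm⟩
  have h := LinearMap.congr_fun this f
  simpa [LinearMap.sum_apply] using h

/-- The vector of `S^{n-k,k}` that is invariant under the permutations preserving `A`. -/
def invariantVec (n h k : ℕ) : SubsetFun n := fun X =>
  if X.card = k then
    (-1) ^ (X ∩ setA n h).card * (((h - (X ∩ setA n h).card).factorial : ℂ)
      * ((n - h - k + (X ∩ setA n h).card).factorial : ℂ))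
  else 0

/-- For `|Y| = k - 1` and `|Y ∩ A| = j` there are `h - j` ways to enlarge `Y` inside `A` and `n - h
- k + j + 1` ways inside `B`. These counts complete the factorials, and the two contributions become
equal with opposite signs. -/
theorem invariantVec_mem_specht {n h k : ℕ} (hk : k ≤ h) (hh : h ≤ n - k) (hkn : k ≤ n) :
    invariantVec n h k ∈ specht n k := by
  refine ⟨fun X hX => if_neg hX, LinearMap.mem_ker.mpr ?_⟩
  ext Y
  rw [radonD_apply, Pi.zero_apply]
  by_cases hY : Y.card + 1 = k
  · have hcA := card_compl_inter_add Y (setA n h)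
    have hcB := card_compl_inter_add Y (setA n h)ᶜ
    have hY' := card_inter_add_card_inter_compl Y (setA n h)
    rw [card_setA (by omega)] at hcA
    rw [card_compl_setA (by omega)] at hcB
    set j := (Y ∩ setA n h).card with hj
    rw [sum_split Yᶜ (setA n h) _
      (p := (-1) ^ (j + 1) * (((h - (j + 1)).factorial : ℂ) * ((n - h - k + (j + 1)).factorial : ℂ)))
      (q := (-1) ^ j * (((h - j).factorial : ℂ) * ((n - h - k + j).factorial : ℂ)))]
    · obtain ⟨a, ha⟩ : ∃ a, h = j + a + 1 := ⟨h - j - 1, by omega⟩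
      have e1 : (Yᶜ ∩ setA n h).card = a + 1 := by omega
      have e2 : (Yᶜ ∩ (setA n h)ᶜ).card = n - h - k + j + 1 := by omega
      rw [e1, e2, show h - (j + 1) = a by omega, show h - j = a + 1 by omega, ← add_assoc,
        Nat.factorial_succ, Nat.factorial_succ, nsmul_eq_mul, nsmul_eq_mul]
      push_cast
      ring
    · intro x hx hA
      rw [Finset.mem_compl] at hx
      rw [invariantVec, if_pos (by rw [Finset.card_insert_of_notMem hx, hY]),
        Finset.insert_inter_of_mem hA, Finset.card_insert_of_notMem (by simp [hx])]
    · intro x hx hA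
      rw [Finset.mem_compl] at hx
      rw [invariantVec, if_pos (by rw [Finset.card_insert_of_notMem hx, hY]),
        Finset.insert_inter_of_notMem hA]
  · refine Finset.sum_eq_zero fun x hx => if_neg ?_
    rwa [Finset.card_insert_of_notMem (Finset.mem_compl.mp hx)]

/-- The coefficient of `x₁^{h-k} y₁^{n-h} x₂^k` sees only the `k`-subsets of `A`, and the vector is
constant on these, so nothing cancels. -/
theorem schurWeyl_invariantVec_ne_zero {n h k : ℕ} (hk : k ≤ h) (hh : h ≤ n - k) (hkn : k ≤ n) :
    schurWeyl n h (invariantVec n h k) ≠ 0 := by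
  intro h0
  have h1 : bicoeff (h - k) (n - h) k 0 (schurWeyl n h (invariantVec n h k)) = 0 := by
    rw [h0, map_zero]
  have h2 : bicoeff (h - k) (n - h) k 0 (schurWeyl n h (invariantVec n h k))
      = ((-1) ^ k * (((h - k).factorial : ℂ) * ((n - h - k + k).factorial : ℂ)))
        * ((Finset.univ.filter fun X : Finset (Fin n) => X.card = k ∧ X ⊆ setA n h).card : ℂ) := by
    rw [schurWeyl, Fintype.linearCombination_apply, map_sum, Finset.card_filter, Nat.cast_sum,
      Finset.mul_sum]
    refine Finset.sum_congr rfl fun X _ => ?_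
    change bicoeff _ _ _ _ (_ • bimono _ _ _ _) = _
    rw [map_smul, bicoeff_bimono, smul_eq_mul]
    have hcA := card_compl_inter_add X (setA n h)
    have hcB := card_compl_inter_add X (setA n h)ᶜ
    have hX := card_inter_add_card_inter_compl X (setA n h)
    rw [card_setA (by omega)] at hcA
    rw [card_compl_setA (by omega)] at hcB
    have hsub : X ⊆ setA n h ↔ (X ∩ (setA n h)ᶜ).card = 0 := by
      rw [Finset.card_eq_zero, ← Finset.sdiff_eq_inter_compl, Finset.sdiff_eq_empty_iff_subset]
    by_cases hc : X.card = k ∧ X ⊆ setA n h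
    · have hc2 := hsub.mp hc.2
      rw [if_pos (by omega), if_pos hc, invariantVec, if_pos hc.1,
        show (X ∩ setA n h).card = k by omega]
      simp
    · rw [if_neg (by rw [hsub] at hc; omega), if_neg hc]
      simp
  rw [h1] at h2
  refine (mul_ne_zero (mul_ne_zero (by simp) (mul_ne_zero ?_ ?_)) ?_) h2.symm
  · exact Nat.cast_ne_zero.mpr (Nat.factorial_ne_zero _)
  · exact Nat.cast_ne_zero.mpr (Nat.factorial_ne_zero _)
  · obtain ⟨X, hX, hc⟩ := Finset.exists_subset_card_eq (s := setA n h) (n := k)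
      (by rw [card_setA (by omega)]; exact hk)
    exact Nat.cast_ne_zero.mpr (Finset.card_ne_zero_of_mem (a := X) (by simp [hX, hc]))

/-! ### The kernel of the lowering polarization -/

theorem bimono_mul (a b c d a' b' c' d' : ℕ) :
    bimono a b c d * bimono a' b' c' d' = bimono (a + a') (b + b') (c + c') (d + d') := by
  rw [bimono, bimono, Algebra.TensorProduct.tmul_mul_tmul, mono_mul_mono, mono_mul_mono, bimono]

theorem one_eq_bimono : (1 : Pol2) = bimono 0 0 0 0 := by
  simp [bimono, mono, Algebra.TensorProduct.one_def]

theorem bimono_pow (a b c d k : ℕ) :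
    bimono a b c d ^ k = bimono (k * a) (k * b) (k * c) (k * d) := by
  induction k with
  | zero => simp [one_eq_bimono]
  | succ k ih => rw [pow_succ, ih, bimono_mul]; congr 1 <;> ring

/-- The invariant `x₁ y₂ - y₁ x₂`. -/
def detPol : Pol2 := bimono 1 0 0 1 - bimono 0 1 1 0

theorem detPol_pow (k : ℕ) :
    detPol ^ k
      = ∑ j ∈ Finset.range (k + 1), ((-1) ^ j * (k.choose j : ℂ)) • bimono (k - j) j j (k - j) := by
  rw [detPol, sub_eq_neg_add, ← neg_one_smul ℂ (bimono 0 1 1 0), add_pow]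
  refine Finset.sum_congr rfl fun j _ => ?_
  rw [smul_pow, bimono_pow, bimono_pow, smul_mul_assoc, bimono_mul, ← nsmul_eq_mul',
    ← Nat.cast_smul_eq_nsmul ℂ, smul_smul, mul_comm ((-1 : ℂ) ^ j)]
  simp

/-- The map `P ↦ (x₁ y₂ - y₁ x₂)^k P(x₁, y₁)`. -/
def kerEmb (k : ℕ) : Pol →ₗ[ℂ] Pol2 :=
  LinearMap.mulLeft ℂ (detPol ^ k) ∘ₗ
    (Algebra.TensorProduct.includeLeft : Pol →ₐ[ℂ] Pol2).toLinearMap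

theorem kerEmb_apply (k : ℕ) (P : Pol) : kerEmb k P = detPol ^ k * (P ⊗ₜ[ℂ] 1) := rfl

theorem kerEmb_mono' (k p q : ℕ) : kerEmb k (mono p q) = detPol ^ k * bimono p q 0 0 := by
  rw [kerEmb_apply, bimono]
  simp [mono]

theorem kerEmb_mono (k p q : ℕ) :
    kerEmb k (mono p q) = ∑ j ∈ Finset.range (k + 1),
      ((-1) ^ j * (k.choose j : ℂ)) • bimono (p + (k - j)) (q + j) j (k - j) := by
  rw [kerEmb_mono', detPol_pow, Finset.sum_mul]
  refine Finset.sum_congr rfl fun j _ => ?_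
  rw [smul_mul_assoc, bimono_mul, add_comm p, add_comm q, add_zero, add_zero]

theorem kerEmb_mono_mem_tens {k n p q : ℕ} (hk : 2 * k ≤ n) (h : p + q = n - 2 * k) :
    kerEmb k (mono p q) ∈ tens (n - k) k := by
  rw [kerEmb_mono]
  refine Submodule.sum_mem _ fun j hj => Submodule.smul_mem _ _ ?_
  rw [Finset.mem_range] at hj
  exact bimono_mem_tens (by omega) (by omega)

/-- `D` is a derivation and `D(x₁y₂ - y₁x₂) = x₁y₁ - y₁x₁ = 0`. -/
theorem polarLower_detPol_mul (f : Pol2) : polarLower (detPol * f) = detPol * polarLower f := by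
  have : polarLower ∘ₗ LinearMap.mulLeft ℂ detPol = LinearMap.mulLeft ℂ detPol ∘ₗ polarLower := by
    refine linearMap_ext_bimono fun a b c d => ?_
    simp only [LinearMap.comp_apply, LinearMap.mulLeft_apply, polarLower_bimono, detPol, sub_mul,
      mul_add, mul_smul_comm, bimono_mul, map_sub]
    rcases c with _ | c <;> rcases d with _ | d <;>
      simp only [Nat.add_sub_cancel, Nat.cast_zero, zero_smul,
        Nat.cast_add, Nat.cast_one, Nat.zero_add, Nat.add_zero, ← add_assoc, add_comm 1] <;>
      module
  exact LinearMap.congr_fun this f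

theorem polarRaise_detPol_mul (f : Pol2) : polarRaise (detPol * f) = detPol * polarRaise f := by
  have : polarRaise ∘ₗ LinearMap.mulLeft ℂ detPol = LinearMap.mulLeft ℂ detPol ∘ₗ polarRaise := by
    refine linearMap_ext_bimono fun a b c d => ?_
    simp only [LinearMap.comp_apply, LinearMap.mulLeft_apply, polarRaise_bimono, detPol, sub_mul,
      mul_add, mul_smul_comm, bimono_mul, map_sub]
    rcases a with _ | a <;> rcases b with _ | b <;>
      simp only [Nat.add_sub_cancel, Nat.cast_zero, zero_smul,
        Nat.cast_add, Nat.cast_one, Nat.zero_add, Nat.add_zero, ← add_assoc, add_comm 1] <;>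
      module
  exact LinearMap.congr_fun this f

theorem polarLower_kerEmb (k p q : ℕ) : polarLower (kerEmb k (mono p q)) = 0 := by
  rw [kerEmb_mono']
  induction k with
  | zero => simp [polarLower_bimono]
  | succ k ih => rw [pow_succ', mul_assoc, polarLower_detPol_mul, ih, mul_zero]

theorem map_kerEmb_le {n k : ℕ} (hk : 2 * k ≤ n) :
    (V (n - 2 * k)).map (kerEmb k) ≤ polarKer n k := by
  rw [Submodule.map_le_iff_le_comap, V_eq_span, Submodule.span_le]
  rintro _ ⟨p, q, h, rfl⟩
  exact ⟨kerEmb_mono_mem_tens hk h, LinearMap.mem_ker.mpr (polarLower_kerEmb k p q)⟩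

/-- The only term of `Δ^k` free of `x₂` is `x₁^k y₂^k`, so the coefficients of the image without
`x₂` recover `P`. -/
theorem bicoeff_kerEmb (k p q : ℕ) (P : Pol) :
    bicoeff (p + k) q 0 k (kerEmb k P) = P.coeff (expo p q) := by
  have : bicoeff (p + k) q 0 k ∘ₗ kerEmb k = MvPolynomial.lcoeff ℂ (expo p q) := by
    refine (MvPolynomial.basisMonomials (Fin 2) ℂ).ext fun e => ?_
    rw [MvPolynomial.coe_basisMonomials, ← expo_eta e]
    simp only
    rw [← mono_eq_monomial, LinearMap.comp_apply,
      kerEmb_mono, map_sum, Finset.sum_range_succ', Finset.sum_eq_zero]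
    · rw [map_smul, bicoeff_bimono, MvPolynomial.lcoeff_apply, coeff_mono]
      simp
    · intro j _
      rw [map_smul, bicoeff_bimono, if_neg (by omega), smul_zero]
  exact LinearMap.congr_fun this P

theorem kerEmb_injective (k : ℕ) : Function.Injective (kerEmb k) := by
  rw [← LinearMap.ker_eq_bot, LinearMap.ker_eq_bot']
  intro P hP
  ext e
  rw [← expo_eta e, ← bicoeff_kerEmb k, hP, map_zero, MvPolynomial.coeff_zero]

/-- An element of the kernel is determined by its coefficients that are free of `x₂`. -/
theorem eq_zero_of_mem_polarKer {n k : ℕ} (hk : 2 * k ≤ n) {f : Pol2} (hf : f ∈ polarKer n k)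
    (h : ∀ p q, p + q = n - 2 * k → bicoeff (p + k) q 0 k f = 0) : f = 0 := by
  have hrec : ∀ a b c d : ℕ, (if a = 0 then 0 else ((c : ℂ) + 1) * bicoeff (a - 1) b (c + 1) d f)
      + (if b = 0 then 0 else ((d : ℂ) + 1) * bicoeff a (b - 1) c (d + 1) f) = 0 := by
    intro a b c d
    rw [← bicoeff_polarLower, LinearMap.mem_ker.mp hf.2, map_zero]
  have hpos : ∀ c : ℕ, (c : ℂ) + 1 ≠ 0 := Nat.cast_add_one_ne_zero
  -- Weights below `k` do not occur in the kernel. For `a = 0` the recursion has a single term; the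
  -- induction on `a` then trades a factor `x₁` for a factor `x₂`, keeping the weight.
  have hlow : ∀ a b c d, a + c < k → c + d = k → bicoeff a b c d f = 0 := by
    intro a
    induction a with
    | zero =>
      intro b c d h1 h2
      obtain ⟨d, rfl⟩ : ∃ d', d = d' + 1 := ⟨d - 1, by omega⟩
      have := hrec 0 (b + 1) c d
      simpa [hpos] using this
    | succ a ih =>
      intro b c d h1 h2
      obtain ⟨d, rfl⟩ : ∃ d', d = d' + 1 := ⟨d - 1, by omega⟩
      have := hrec (a + 1) (b + 1) c d
      simpa [hpos, ih (b + 1) (c + 1) d (by omega) (by omega)] using this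
  -- The recursion expresses a coefficient with `x₂^{c+1}` through one with `x₂^c`. At `c = 0` the
  -- hypothesis covers `a ≥ k`, and `hlow` covers `a < k`.
  have hall : ∀ c a b d, a + b = n - k → c + d = k → bicoeff a b c d f = 0 := by
    intro c
    induction c with
    | zero =>
      intro a b d h1 h2
      obtain rfl : d = k := by omega
      by_cases ha : a < d
      · exact hlow a b 0 d (by omega) (by omega)
      · obtain ⟨p, rfl⟩ := Nat.exists_eq_add_of_le' (not_lt.mp ha)
        exact h p b (by omega)
    | succ c ih =>
      intro a b d h1 h2
      have := hrec (a + 1) b c d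
      by_cases hb : b = 0
      · simpa [hb, hpos] using this
      · have h3 := ih (a + 1) (b - 1) (d + 1) (by omega) (by omega)
        simpa [hb, hpos, h3] using this
  refine eq_zero_of_bicoeff fun a b c d => ?_
  by_cases hd : a + b = n - k ∧ c + d = k
  · exact hall c a b d hd.1 hd.2
  · exact bicoeff_eq_zero hf.1 hd

/-- The candidate `P` is read off from the terms of `f` free of `x₂`; then `f - Δ^k P` lies in the
kernel and has no such terms. -/
theorem polarKer_eq_map {n k : ℕ} (hk : 2 * k ≤ n) :
    polarKer n k = (V (n - 2 * k)).map (kerEmb k) := by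
  refine le_antisymm (fun f hf => ?_) (map_kerEmb_le hk)
  set P : Pol := ∑ e ∈ Finset.HasAntidiagonal.antidiagonal (n - 2 * k),
    bicoeff (e.1 + k) e.2 0 k f • mono e.1 e.2 with hP
  have hPV : P ∈ V (n - 2 * k) := by
    refine Submodule.sum_mem _ fun e he => Submodule.smul_mem _ _ ?_
    rw [V_eq_span]
    exact Submodule.subset_span ⟨e.1, e.2, Finset.HasAntidiagonal.mem_antidiagonal.mp he, rfl⟩
  have hmem : kerEmb k P ∈ (V (n - 2 * k)).map (kerEmb k) := Submodule.mem_map_of_mem hPV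
  have h0 : f - kerEmb k P = 0 := by
    refine eq_zero_of_mem_polarKer hk (Submodule.sub_mem _ hf (map_kerEmb_le hk hmem)) ?_
    intro p q hpq
    rw [map_sub, bicoeff_kerEmb, hP, MvPolynomial.coeff_sum,
      Finset.sum_eq_single_of_mem (p, q) (Finset.HasAntidiagonal.mem_antidiagonal.mpr hpq)]
    · rw [MvPolynomial.coeff_smul, coeff_mono]
      simp
    · rintro ⟨p', q'⟩ _ hne
      rw [MvPolynomial.coeff_smul, coeff_mono, if_neg, smul_zero]
      rintro ⟨rfl, rfl⟩
      exact hne rfl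
  rw [sub_eq_zero.mp h0]
  exact hmem

theorem cgSummand_eq_map {n m k : ℕ} (hk : 2 * k ≤ n) :
    cgSummand n m k = (V (n - 2 * k)).map ((polarRaise ^ (m - k) : Module.End ℂ Pol2) ∘ₗ kerEmb k) := by
  rw [cgSummand, polarKer_eq_map hk, Submodule.map_comp]

/-! ### The images of the Schur--Weyl maps -/

/-- In weight `p + k` the only monomial of this bidegree without `x₂` is `x₁^{p+k} y₁^q y₂^k`, so
this weight part of the kernel is at most a line. The image of the invariant vector is a nonzero
element of it and can be rescaled. -/
theorem kerEmb_mono_mem_map_schurWeyl {n k p q : ℕ} (hk : 2 * k ≤ n) (h : p + q = n - 2 * k) :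
    kerEmb k (mono p q) ∈ (specht n k).map (schurWeyl n (p + k)) := by
  set f := invariantVec n (p + k) k with hf
  have hfS : f ∈ specht n k := invariantVec_mem_specht (by omega) (by omega) (by omega)
  have hf0 : schurWeyl n (p + k) f ≠ 0 :=
    schurWeyl_invariantVec_ne_zero (by omega) (by omega) (by omega)
  have hmem := schurWeyl_specht_le (Submodule.mem_map_of_mem (f := schurWeyl n (p + k)) hfS)
  have hw : schurWeyl n (p + k) f ∈ weightSpace (p + k) :=
    schurWeyl_mem_weightSpace (by omega) f
  set c := bicoeff (p + k) q 0 k (schurWeyl n (p + k) f) with hc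
  have hEmem : kerEmb k (mono p q) ∈ polarKer n k :=
    ⟨kerEmb_mono_mem_tens hk h, LinearMap.mem_ker.mpr (polarLower_kerEmb k p q)⟩
  have heq : schurWeyl n (p + k) f - c • kerEmb k (mono p q) = 0 := by
    refine eq_zero_of_mem_polarKer hk
      (Submodule.sub_mem _ hmem (Submodule.smul_mem _ _ hEmem)) fun p' q' h' => ?_
    rw [map_sub, map_smul, bicoeff_kerEmb, coeff_mono]
    by_cases hp : p' = p
    · obtain rfl : q' = q := by omega
      subst hp
      simp [hc]
    · rw [bicoeff_eq_zero_of_weight hw (by omega), if_neg (by tauto), smul_zero, sub_zero]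
  rw [sub_eq_zero] at heq
  have hc0 : c ≠ 0 := by
    intro h0
    rw [h0, zero_smul] at heq
    exact hf0 heq
  refine ⟨c⁻¹ • f, Submodule.smul_mem _ _ hfS, ?_⟩
  rw [map_smul, heq, inv_smul_smul₀ hc0]

theorem iSupIndep_map_schurWeyl (n k : ℕ) (S : Submodule ℂ (SubsetFun n)) :
    iSupIndep (fun h : Finset.Icc k (n - k) => S.map (schurWeyl n h)) := by
  refine (iSupIndep_weightSpace.comp (Subtype.val_injective
    (p := fun h => h ∈ Finset.Icc k (n - k)))).mono ?_
  rintro ⟨h, hh⟩ _ ⟨f, _, rfl⟩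
  have hh' := Finset.mem_Icc.mp hh
  exact schurWeyl_mem_weightSpace (n := n) (h := h) (by omega) f

theorem iSup_map_schurWeyl_specht {n k : ℕ} (hk : 2 * k ≤ n) :
    ⨆ h : Finset.Icc k (n - k), (specht n k).map (schurWeyl n h) = polarKer n k := by
  refine le_antisymm (iSup_le fun h => schurWeyl_specht_le) ?_
  rw [polarKer_eq_map hk, Submodule.map_le_iff_le_comap, V_eq_span, Submodule.span_le]
  rintro _ ⟨p, q, h, rfl⟩
  exact Submodule.mem_iSup_of_mem ⟨p + k, Finset.mem_Icc.mpr (by omega)⟩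
    (kerEmb_mono_mem_map_schurWeyl hk h)

theorem iSup_map_schurWeyl_johnsonSummand {n m k : ℕ} (hk : 2 * k ≤ n) :
    ⨆ h : Finset.Icc k (n - k), (johnsonSummand n m k).map (schurWeyl n h) = cgSummand n m k := by
  simp only [schurWeyl_johnsonSummand]
  rw [← Submodule.map_iSup, iSup_map_schurWeyl_specht hk, cgSummand]

/-! ### Equivariance -/

theorem tensorRep_apply (g : SU2) (f : Pol2) :
    tensorRep g f = Algebra.TensorProduct.map (subst (g : Matrix (Fin 2) (Fin 2) ℂ))
      (subst (g : Matrix (Fin 2) (Fin 2) ℂ)) f := rfl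

theorem tensorRep_tmul (g : SU2) (P Q : Pol) :
    tensorRep g (P ⊗ₜ[ℂ] Q) = subst (g : Matrix (Fin 2) (Fin 2) ℂ) P ⊗ₜ[ℂ]
      subst (g : Matrix (Fin 2) (Fin 2) ℂ) Q := rfl

theorem subst_X (g : Matrix (Fin 2) (Fin 2) ℂ) (i : Fin 2) :
    subst g (MvPolynomial.X i) = g 0 i • MvPolynomial.X 0 + g 1 i • MvPolynomial.X 1 := by
  simp [subst, Fin.sum_univ_two, MvPolynomial.smul_eq_C_mul]

theorem detPol_eq : detPol = MvPolynomial.X 0 ⊗ₜ[ℂ] MvPolynomial.X 1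
    - MvPolynomial.X 1 ⊗ₜ[ℂ] MvPolynomial.X 0 := by
  simp [detPol, bimono, mono]

/-- The substitution multiplies `Δ`, the determinant of the two pairs of variables, by `det g = 1`.
-/
theorem tensorRep_detPol (g : SU2) : tensorRep g detPol = detPol := by
  have hdet : (g : Matrix (Fin 2) (Fin 2) ℂ) 0 0 * (g : Matrix (Fin 2) (Fin 2) ℂ) 1 1
      - (g : Matrix (Fin 2) (Fin 2) ℂ) 0 1 * (g : Matrix (Fin 2) (Fin 2) ℂ) 1 0 = 1 := by
    rw [← Matrix.det_fin_two]
    exact (Matrix.mem_specialUnitaryGroup_iff.mp g.2).2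
  rw [detPol_eq, map_sub, tensorRep_tmul, tensorRep_tmul, subst_X, subst_X]
  simp only [TensorProduct.add_tmul, TensorProduct.tmul_add, TensorProduct.tmul_smul]
  simp only [← TensorProduct.smul_tmul']
  rw [← one_smul ℂ (MvPolynomial.X 0 ⊗ₜ[ℂ] MvPolynomial.X 1 - MvPolynomial.X 1 ⊗ₜ[ℂ] MvPolynomial.X 0
    : Pol2), ← hdet]
  module

theorem tensorRep_kerEmb (g : SU2) (k : ℕ) (P : Pol) :
    kerEmb k (polRep g P) = tensorRep g (kerEmb k P) := by
  rw [kerEmb_apply, kerEmb_apply, tensorRep_apply, map_mul, map_pow, ← tensorRep_apply,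
    tensorRep_detPol, Algebra.TensorProduct.map_tmul, map_one]
  rfl

/-- Chain rule. The derivatives transform dually to the variables, which is why the contraction `∑
∂_i ⊗ X_i` defining `D*` commutes with the group. -/
theorem pderiv_subst (g : Matrix (Fin 2) (Fin 2) ℂ) (i : Fin 2) (P : Pol) :
    MvPolynomial.pderiv i (subst g P)
      = g i 0 • subst g (MvPolynomial.pderiv 0 P) + g i 1 • subst g (MvPolynomial.pderiv 1 P) := by
  induction P using MvPolynomial.induction_on with
  | C a => simp [subst]
  | add P Q hP hQ =>
    simp only [map_add, hP, hQ]
    module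
  | mul_X P j hP =>
    have hX : MvPolynomial.pderiv i (subst g (MvPolynomial.X j)) = MvPolynomial.C (g i j) := by
      rw [subst_X]
      fin_cases i <;> simp [MvPolynomial.pderiv_X, MvPolynomial.smul_eq_C_mul]
    simp only [map_mul, Derivation.leibniz, hP, hX, smul_eq_mul, map_add, MvPolynomial.pderiv_X]
    fin_cases j <;> simp [MvPolynomial.smul_eq_C_mul] <;> ring

theorem polarRaise_tmul (P Q : Pol) :
    polarRaise (P ⊗ₜ[ℂ] Q) = MvPolynomial.pderiv 0 P ⊗ₜ[ℂ] (MvPolynomial.X 0 * Q)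
      + MvPolynomial.pderiv 1 P ⊗ₜ[ℂ] (MvPolynomial.X 1 * Q) := by
  simp [polarRaise, Fin.sum_univ_two]

theorem tensorRep_polarRaise (g : SU2) (f : Pol2) :
    tensorRep g (polarRaise f) = polarRaise (tensorRep g f) := by
  have : tensorRep g ∘ₗ polarRaise = polarRaise ∘ₗ tensorRep g := by
    refine TensorProduct.ext' fun P Q => ?_
    simp only [LinearMap.comp_apply, polarRaise_tmul, tensorRep_tmul, map_add, pderiv_subst,
      map_mul, subst_X, add_mul, TensorProduct.add_tmul, TensorProduct.tmul_add, smul_mul_assoc,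
      TensorProduct.tmul_smul, ← TensorProduct.smul_tmul']
    module
  exact LinearMap.congr_fun this f

theorem tensorRep_polarRaise_pow (g : SU2) (q : ℕ) (f : Pol2) :
    tensorRep g ((polarRaise ^ q) f) = (polarRaise ^ q) (tensorRep g f) := by
  induction q with
  | zero => simp
  | succ q ih =>
    rw [pow_succ', Module.End.mul_apply, Module.End.mul_apply, tensorRep_polarRaise, ih]

theorem coe_spinRep (d : ℕ) (g : SU2) (v : V d) : (spinRep d g v : Pol) = polRep g v := rfl

theorem isoSpin_range {d : ℕ} {F : V d →ₗ[ℂ] Pol2} (hinj : Function.Injective F)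
    (hF : ∀ (g : SU2) (v : V d), F (spinRep d g v) = tensorRep g (F v)) :
    IsoSpin (LinearMap.range F) d := by
  refine ⟨⟨LinearMap.range F, ?_⟩, rfl, ⟨.mk' ⟨(LinearEquiv.ofInjective F hinj).toLinearMap, ?_⟩
    (LinearEquiv.ofInjective F hinj).symm (LinearEquiv.ofInjective F hinj).left_inv
    (LinearEquiv.ofInjective F hinj).right_inv⟩⟩
  · rintro g _ ⟨v, rfl⟩
    exact ⟨spinRep d g v, hF g v⟩
  · intro g
    ext v
    exact hF g v

/-- The intertwining map of `V_{n/2-k}` onto the `k`-th summand. -/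
def cgMap (n m k : ℕ) : V (n - 2 * k) →ₗ[ℂ] Pol2 :=
  (polarRaise ^ (m - k) : Module.End ℂ Pol2) ∘ₗ kerEmb k ∘ₗ (V (n - 2 * k)).subtype

theorem cgMap_apply (n m k : ℕ) (v : V (n - 2 * k)) :
    cgMap n m k v = (polarRaise ^ (m - k)) (kerEmb k v) := rfl

theorem kerEmb_mem_polarKer {n k : ℕ} (hk : 2 * k ≤ n) (v : V (n - 2 * k)) :
    kerEmb k v ∈ polarKer n k := map_kerEmb_le hk (Submodule.mem_map_of_mem v.2)

theorem cgMap_equivariant (n m k : ℕ) (g : SU2) (v : V (n - 2 * k)) :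
    cgMap n m k (spinRep _ g v) = tensorRep g (cgMap n m k v) := by
  rw [cgMap_apply, cgMap_apply, tensorRep_polarRaise_pow, coe_spinRep, tensorRep_kerEmb]

theorem cgMap_injective {n m k : ℕ} (hk : k ≤ min (n - m) m) (hm : m ≤ n) :
    Function.Injective (cgMap n m k) := by
  rw [← LinearMap.ker_eq_bot, LinearMap.ker_eq_bot']
  intro v hv
  have h1 := kerEmb_mem_polarKer (n := n) (k := k) (by omega) v
  rw [← primitive_tensGrade (by omega)] at h1
  have h2 := (isLadder_tensGrade n).pow_injOn_primitive (q := m - k) (by omega) h1 hv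
  exact Subtype.ext (kerEmb_injective k (by rw [h2, ZeroMemClass.coe_zero, map_zero]))

theorem range_cgMap {n m k : ℕ} (hk : 2 * k ≤ n) :
    LinearMap.range (cgMap n m k) = cgSummand n m k := by
  rw [cgSummand_eq_map hk, cgMap, ← LinearMap.comp_assoc, LinearMap.range_comp,
    Submodule.range_subtype]

theorem isoSpin_cgSummand {n m k : ℕ} (hm : m ≤ n) (hk : k ≤ min (n - m) m) :
    IsoSpin (cgSummand n m k) (n - 2 * k) := by
  rw [← range_cgMap (by omega)]
  exact isoSpin_range (cgMap_injective hk hm) (cgMap_equivariant n m k)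

theorem isoSpin_polarKer {n k : ℕ} (hk : 2 * k ≤ n) : IsoSpin (polarKer n k) (n - 2 * k) := by
  have h := isoSpin_cgSummand (n := n) (m := k) (k := k) (by omega) (by omega)
  rwa [cgSummand, Nat.sub_self, pow_zero, Module.End.one_eq_id, Submodule.map_id] at h

/-! ### Scalar products -/

theorem inner_bimono (a b c d a' b' c' d' : ℕ) :
    inner ℂ (bimono a b c d) (bimono a' b' c' d')
      = if (a = a' ∧ b = b') ∧ c = c' ∧ d = d' then
          (((a + b).choose a : ℂ))⁻¹ * (((c + d).choose c : ℂ))⁻¹ else 0 := by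
  rw [bimono, bimono, TensorProduct.inner_tmul, inner_mono, inner_mono]
  split_ifs <;> simp_all

theorem smul_inner_pol2 (r : ℂ) (f g : Pol2) : inner ℂ (r • f) g = conj r * inner ℂ f g :=
  inner_smul_left f g r

theorem inner_smul_pol2 (r : ℂ) (f g : Pol2) : inner ℂ f (r • g) = r * inner ℂ f g :=
  inner_smul_right f g r

/-- Sesquilinearity reduces an identity of scalar products to spanning sets. Separate linear maps in
the slots let it serve both for the adjointness of `D*` and `D` and for comparing norms. -/
theorem inner_eq_on_span {E E' X Y : Type*} [AddCommGroup E] [Module ℂ E] [AddCommGroup E']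
    [Module ℂ E'] [NormedAddCommGroup X] [InnerProductSpace ℂ X] [NormedAddCommGroup Y]
    [InnerProductSpace ℂ Y] {F : E →ₗ[ℂ] X} {G : E' →ₗ[ℂ] X} {F' : E →ₗ[ℂ] Y} {G' : E' →ₗ[ℂ] Y}
    {r s : ℂ} {S : Set E} {T : Set E'}
    (h : ∀ x ∈ S, ∀ y ∈ T, r * inner ℂ (F x) (G y) = s * inner ℂ (F' x) (G' y))
    {x : E} {y : E'} (hx : x ∈ Submodule.span ℂ S) (hy : y ∈ Submodule.span ℂ T) :
    r * inner ℂ (F x) (G y) = s * inner ℂ (F' x) (G' y) := by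
  induction hx using Submodule.span_induction with
  | mem x hx =>
    induction hy using Submodule.span_induction with
    | mem y hy => exact h x hx y hy
    | zero => simp
    | add y z _ _ h1 h2 => simp only [map_add, inner_add_right, mul_add, h1, h2]
    | smul c y _ h1 =>
      simp only [map_smul, inner_smul_right]
      linear_combination c * h1
  | zero => simp
  | add y z _ _ h1 h2 => simp only [map_add, inner_add_left, mul_add, h1, h2]
  | smul c y _ h1 =>
    simp only [map_smul, inner_smul_left]
    linear_combination conj c * h1

theorem cast_choose_ne_zero {n k : ℕ} (h : k ≤ n) : (n.choose k : ℂ) ≠ 0 :=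
  Nat.cast_ne_zero.mpr (Nat.choose_pos h).ne'

/-- This follows from `(N+1) binom(N, a) = (a+1) binom(N+1, a+1)` in each tensor factor. The factors
`p + 1` and `q + 1` arise because the norms of monomials depend on the total degree. -/
theorem adjoint_coeff {p q a b c d : ℕ} (hab : a + b = p) (hcd : c + d = q) :
    ((q : ℂ) + 1) * (((a : ℂ) + 1) * ((((a + b).choose a : ℂ))⁻¹ * (((c + 1 + d).choose (c + 1) : ℂ))⁻¹))
      = ((p : ℂ) + 1) * (((c : ℂ) + 1) *
        ((((a + 1 + b).choose (a + 1) : ℂ))⁻¹ * (((c + d).choose c : ℂ))⁻¹)) := by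
  subst hab hcd
  have h1 : ((a : ℂ) + b + 1) * ((a + b).choose a : ℂ)
      = ((a + 1 + b).choose (a + 1) : ℂ) * ((a : ℂ) + 1) := by
    rw [show a + 1 + b = a + b + 1 by ring]
    exact_mod_cast Nat.add_one_mul_choose_eq (a + b) a
  have h2 : ((c : ℂ) + d + 1) * ((c + d).choose c : ℂ)
      = ((c + 1 + d).choose (c + 1) : ℂ) * ((c : ℂ) + 1) := by
    rw [show c + 1 + d = c + d + 1 by ring]
    exact_mod_cast Nat.add_one_mul_choose_eq (c + d) c
  have e1 := cast_choose_ne_zero (Nat.le_add_right a b)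
  have e2 := cast_choose_ne_zero (Nat.le_add_right c d)
  have e3 := cast_choose_ne_zero (Nat.le_add_right (a + 1) b)
  have e4 := cast_choose_ne_zero (Nat.le_add_right (c + 1) d)
  push_cast
  field_simp
  linear_combination ((c : ℂ) + d + 1) * ((c + d).choose c : ℂ) * (-h1)
    + ((a + b).choose a : ℂ) * ((a : ℂ) + b + 1) * h2

/-- Up to normalization, the polarization operators are adjoint to each other. -/
theorem inner_polarRaise {p q : ℕ} {f g : Pol2} (hf : f ∈ tens (p + 1) q)
    (hg : g ∈ tens p (q + 1)) :
    ((q : ℂ) + 1) * inner ℂ (polarRaise f) g = ((p : ℂ) + 1) * inner ℂ f (polarLower g) := by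
  rw [tens_eq_span] at hf hg
  refine inner_eq_on_span (F := polarRaise) (G := LinearMap.id) (F' := LinearMap.id)
    (G' := polarLower) ?_ hf hg
  rintro _ ⟨a, b, c, d, h1, h2, rfl⟩ _ ⟨a', b', c', d', h3, h4, rfl⟩
  rw [LinearMap.id_apply, LinearMap.id_apply, polarRaise_bimono, polarLower_bimono]
  simp only [inner_add_left, inner_add_right, smul_inner_pol2, inner_smul_pol2, inner_bimono,
    Complex.conj_natCast, mul_add]
  congr 1
  · rcases a with _ | a
    · simp
    · rcases c' with _ | c'
      · simp
      · simp only [Nat.add_sub_cancel, Nat.add_right_cancel_iff]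
        split_ifs with h
        · obtain ⟨⟨rfl, rfl⟩, rfl, rfl⟩ := h
          exact_mod_cast adjoint_coeff (p := p) (q := q) (by omega) (by omega)
        · simp
  · rcases b with _ | b
    · simp
    · rcases d' with _ | d'
      · simp
      · simp only [Nat.add_sub_cancel, Nat.add_right_cancel_iff]
        split_ifs with h
        · obtain ⟨⟨rfl, rfl⟩, rfl, rfl⟩ := h
          -- The `y`-part is the `x`-part with the two variables exchanged, up to the symmetry of
          -- binomial coefficients.
          have := adjoint_coeff (p := p) (q := q) (a := b) (b := a) (c := d) (d := c)
            (by omega) (by omega)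
          rw [add_comm (b + 1) a, add_comm (d + 1) c, add_comm b a, add_comm d c]
            at this
          rw [Nat.choose_symm_add, Nat.choose_symm_add, Nat.choose_symm_add, Nat.choose_symm_add]
          exact_mod_cast this
        · simp

/-- Moving one `D*` across the scalar product turns it into `D`, which acts on `(D*)^{p+1} g` by a
known factor. Each step multiplies the constant by `(n-k-p)(p+1)(n-2k-p)/(k+p+1)`. -/
theorem inner_polarRaise_pow {n k p : ℕ} (hp : 2 * k + p ≤ n) {f g : Pol2}
    (hf : f ∈ polarKer n k) (hg : g ∈ polarKer n k) :
    inner ℂ ((polarRaise ^ p) f) ((polarRaise ^ p) g)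
      = (((n - k).factorial * p.factorial * (n - 2 * k).factorial * k.factorial : ℕ) : ℂ)
        / (((n - k - p).factorial * (n - 2 * k - p).factorial * (k + p).factorial : ℕ) : ℂ)
        * inner ℂ f g := by
  induction p with
  | zero =>
    have h1 : ((n - k).factorial : ℂ) ≠ 0 := Nat.cast_ne_zero.mpr (Nat.factorial_ne_zero _)
    have h2 : ((n - 2 * k).factorial : ℂ) ≠ 0 := Nat.cast_ne_zero.mpr (Nat.factorial_ne_zero _)
    have h3 : (k.factorial : ℂ) ≠ 0 := Nat.cast_ne_zero.mpr (Nat.factorial_ne_zero _)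
    simp only [pow_zero, Module.End.one_apply, Nat.sub_zero, Nat.add_zero, Nat.factorial_zero]
    push_cast
    field_simp
  | succ p ih =>
    have hL := isLadder_tensGrade n
    have hfP := hf
    have hgP := hg
    rw [← primitive_tensGrade (by omega)] at hfP hgP
    have hf1 := hL.pow_mem hfP.1 p
    have hg1 := hL.pow_mem hgP.1 (p + 1)
    rw [tensGrade_of_le (by omega)] at hf1 hg1
    rw [show n - (k + p) = n - (k + (p + 1)) + 1 by omega] at hf1
    have h1 := inner_polarRaise hf1 hg1
    rw [hL.lower_pow_primitive hgP, inner_smul_right, ← Module.End.mul_apply, ← pow_succ',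
      ih (by omega)] at h1
    obtain ⟨t, rfl⟩ : ∃ t, n = 2 * k + p + 1 + t := ⟨n - (2 * k + p + 1), by omega⟩
    rw [show 2 * k + p + 1 + t - (k + (p + 1)) = k + t by omega,
      show 2 * k + p + 1 + t - k - p = k + t + 1 by omega,
      show 2 * k + p + 1 + t - 2 * k - p = t + 1 by omega] at h1
    rw [show 2 * k + p + 1 + t - k - (p + 1) = k + t by omega,
      show 2 * k + p + 1 + t - 2 * k - (p + 1) = t by omega]
    rw [Nat.factorial_succ (k + t), Nat.factorial_succ t] at h1
    rw [Nat.factorial_succ p, ← add_assoc, Nat.factorial_succ (k + p)]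
    have e1 : ((k + t).factorial : ℂ) ≠ 0 := Nat.cast_ne_zero.mpr (Nat.factorial_ne_zero _)
    have e2 : (t.factorial : ℂ) ≠ 0 := Nat.cast_ne_zero.mpr (Nat.factorial_ne_zero _)
    have e3 : ((k + p).factorial : ℂ) ≠ 0 := Nat.cast_ne_zero.mpr (Nat.factorial_ne_zero _)
    have e4 : (k : ℂ) + p + 1 ≠ 0 := by exact_mod_cast Nat.succ_ne_zero (k + p)
    have e5 : (k : ℂ) + t + 1 ≠ 0 := by exact_mod_cast Nat.succ_ne_zero (k + t)
    have e6 : (t : ℂ) + 1 ≠ 0 := by exact_mod_cast Nat.succ_ne_zero t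
    apply mul_left_cancel₀ e4
    push_cast at h1 ⊢
    rw [h1]
    field_simp
    ring

/-! ### Norms of the vectors `Δ^k x₁^p y₁^q` -/

/-- Compare the coefficients of `X^k` in `(1-X)^{-(a+1)} (1-X)^{-(b+1)} = (1-X)^{-(a+b+2)}`. -/
theorem sum_choose_mul_choose (a b k : ℕ) :
    ∑ j ∈ Finset.range (k + 1), (a + j).choose a * (b + (k - j)).choose b
      = (a + b + 1 + k).choose (a + b + 1) := by
  have h := congrArg (fun f : (PowerSeries ℤ)ˣ => PowerSeries.coeff k f.val)
    (PowerSeries.invOneSubPow_add (S := ℤ) (a + 1) (b + 1))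
  simp only [show a + 1 + (b + 1) = a + b + 1 + 1 by ring, Units.val_mul, PowerSeries.coeff_mul,
    PowerSeries.invOneSubPow_val_succ_eq_mk_add_choose, PowerSeries.coeff_mk] at h
  rw [Finset.Nat.sum_antidiagonal_eq_sum_range_succ_mk] at h
  exact_mod_cast h.symm

/-- The left side is the square norm of `Δ^k x₁^p y₁^q`: one of the two factors `binom(k, j)` has
cancelled against the norm in the second tensor factor. In factorials it becomes a multiple of the
preceding convolution. -/
theorem sum_choose_div_choose (p q k : ℕ) :
    ∑ j ∈ Finset.range (k + 1),
        (k.choose j : ℂ) * (((p + (k - j) + (q + j)).choose (p + (k - j)) : ℂ))⁻¹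
      = ((p : ℂ) + q + k + 1) / ((p : ℂ) + q + 1) * (((p + q).choose p : ℂ))⁻¹ := by
  have hterm : ∀ j ∈ Finset.range (k + 1),
      (k.choose j : ℂ) * (((p + (k - j) + (q + j)).choose (p + (k - j)) : ℂ))⁻¹
        = (k.factorial * p.factorial * q.factorial : ℂ) / (p + q + k).factorial
          * (((q + j).choose q * (p + (k - j)).choose p : ℕ) : ℂ) := by
    intro j hj
    obtain ⟨i, rfl⟩ := Nat.exists_eq_add_of_le (Nat.lt_succ_iff.mp (Finset.mem_range.mp hj))
    rw [Nat.add_sub_cancel_left, Nat.cast_mul, Nat.cast_add_choose, Nat.cast_add_choose,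
      Nat.cast_add_choose, Nat.cast_add_choose, show p + i + (q + j) = p + q + (j + i) by ring]
    have e : ∀ m : ℕ, (m.factorial : ℂ) ≠ 0 := fun m =>
      Nat.cast_ne_zero.mpr (Nat.factorial_ne_zero m)
    have e1 := e p
    have e2 := e q
    have e3 := e i
    have e4 := e j
    have e5 := e (p + i)
    have e6 := e (q + j)
    have e7 := e (p + q + (j + i))
    have e8 := e (j + i)
    field_simp
  rw [Finset.sum_congr rfl hterm, ← Finset.mul_sum, ← Nat.cast_sum, sum_choose_mul_choose,
    Nat.cast_add_choose, Nat.cast_add_choose, show q + p + 1 + k = p + q + k + 1 by ring,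
    show q + p + 1 = p + q + 1 by ring, Nat.factorial_succ, Nat.factorial_succ]
  have e : ∀ m : ℕ, (m.factorial : ℂ) ≠ 0 := fun m =>
    Nat.cast_ne_zero.mpr (Nat.factorial_ne_zero m)
  have e1 := e p
  have e2 := e q
  have e3 := e (p + q + k)
  have e4 := e k
  have e5 := e (p + q)
  have e6 : (p : ℂ) + q + 1 ≠ 0 := by exact_mod_cast Nat.succ_ne_zero (p + q)
  push_cast
  field_simp

theorem inner_kerEmb_mono (k p q p' q' : ℕ) (h : p + q = p' + q') :
    inner ℂ (kerEmb k (mono p q)) (kerEmb k (mono p' q'))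
      = ((p : ℂ) + q + k + 1) / ((p : ℂ) + q + 1) * inner ℂ (mono p q) (mono p' q') := by
  rw [kerEmb_mono, kerEmb_mono, sum_inner]
  simp only [inner_sum, smul_inner_pol2, inner_smul_pol2, inner_bimono]
  by_cases hp : p = p'
  · obtain rfl : q = q' := by omega
    subst hp
    rw [inner_mono, if_pos ⟨rfl, rfl⟩, ← sum_choose_div_choose]
    refine Finset.sum_congr rfl fun j hj => ?_
    rw [Finset.sum_eq_single_of_mem j hj]
    · have hj' := Nat.lt_succ_iff.mp (Finset.mem_range.mp hj)
      have h1 := cast_choose_ne_zero hj'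
      have hs : ((-1 : ℂ) ^ j) * (-1) ^ j = 1 := by rw [← mul_pow]; simp
      rw [if_pos ⟨⟨rfl, rfl⟩, rfl, rfl⟩, Nat.add_sub_cancel' hj']
      simp only [map_mul, map_pow, map_neg, map_one, Complex.conj_natCast]
      linear_combination (-1 : ℂ) ^ j * (-1) ^ j * (k.choose j : ℂ)
          * (((p + (k - j) + (q + j)).choose (p + (k - j)) : ℂ))⁻¹ * mul_inv_cancel₀ h1
        + (k.choose j : ℂ) * (((p + (k - j) + (q + j)).choose (p + (k - j)) : ℂ))⁻¹ * hs
    · intro j' _ hne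
      rw [if_neg (by omega)]
      simp
  · rw [inner_mono, if_neg (by tauto), mul_zero]
    refine Finset.sum_eq_zero fun j hj => Finset.sum_eq_zero fun j' hj' => ?_
    rw [Finset.mem_range] at hj hj'
    rw [if_neg (by omega)]
    simp

theorem inner_kerEmb {N k : ℕ} {P Q : Pol} (hP : P ∈ V N) (hQ : Q ∈ V N) :
    inner ℂ (kerEmb k P) (kerEmb k Q)
      = ((N : ℂ) + k + 1) / ((N : ℂ) + 1) * inner ℂ P Q := by
  rw [V_eq_span] at hP hQ
  rw [← one_mul (inner ℂ (kerEmb k P) (kerEmb k Q))]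
  refine inner_eq_on_span (F := kerEmb k) (G := kerEmb k) (F' := LinearMap.id)
    (G' := LinearMap.id) ?_ hP hQ
  rintro _ ⟨p, q, rfl, rfl⟩ _ ⟨p', q', h, rfl⟩
  rw [one_mul, inner_kerEmb_mono k p q p' q' h.symm]
  push_cast
  rfl

/-- The factor by which `cgMap` changes the scalar product. -/
def cgFactor (n m k : ℕ) : ℝ :=
  (((n - k + 1).factorial * (m - k).factorial * (n - 2 * k).factorial * k.factorial : ℕ) : ℝ)
    / (((n - m).factorial * (n - m - k).factorial * m.factorial * (n - 2 * k + 1) : ℕ) : ℝ)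

theorem cgFactor_pos (n m k : ℕ) : 0 < cgFactor n m k := by
  unfold cgFactor
  positivity

theorem inner_cgMap {n m k : ℕ} (hm : m ≤ n) (hk : k ≤ min (n - m) m) (v v' : V (n - 2 * k)) :
    inner ℂ (cgMap n m k v) (cgMap n m k v') = (cgFactor n m k : ℂ) * inner ℂ (v : Pol) v' := by
  rw [cgMap_apply, cgMap_apply, inner_polarRaise_pow (n := n) (k := k) (by omega)
    (kerEmb_mem_polarKer (by omega) v) (kerEmb_mem_polarKer (by omega) v'),
    inner_kerEmb v.2 v'.2, ← mul_assoc, cgFactor]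
  congr 1
  rw [show n - k - (m - k) = n - m by omega, show n - 2 * k - (m - k) = n - m - k by omega,
    show k + (m - k) = m by omega, Nat.factorial_succ (n - k)]
  have e : ((n - 2 * k : ℕ) : ℂ) + k = ((n - k : ℕ) : ℂ) := by
    rw [← Nat.cast_add]; congr 1; omega
  have e1 : ((n - 2 * k : ℕ) : ℂ) + 1 ≠ 0 := Nat.cast_add_one_ne_zero _
  have e' : ∀ m : ℕ, (m.factorial : ℂ) ≠ 0 := fun m =>
    Nat.cast_ne_zero.mpr (Nat.factorial_ne_zero m)
  have e2 := e' (n - m)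
  have e3 := e' (n - m - k)
  have e4 := e' m
  rw [e]
  push_cast
  field_simp

/-! ### Uniqueness of the intertwining map -/

theorem mono_mem_V_of_eq {d p q : ℕ} (h : p + q = d) : mono p q ∈ V d := by
  rw [V_eq_span]
  exact Submodule.subset_span ⟨p, q, h, rfl⟩

theorem linearMap_ext_V {d : ℕ} {N : Type*} [AddCommMonoid N] [Module ℂ N] {F G : V d →ₗ[ℂ] N}
    (h : ∀ p q, ∀ hpq : p + q = d,
      F ⟨mono p q, mono_mem_V_of_eq hpq⟩ = G ⟨mono p q, mono_mem_V_of_eq hpq⟩) : F = G := by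
  have key : ∀ P ∈ Submodule.span ℂ {P | ∃ p q, p + q = d ∧ P = mono p q},
      ∀ hP : P ∈ V d, F ⟨P, hP⟩ = G ⟨P, hP⟩ := by
    intro P hP
    induction hP using Submodule.span_induction with
    | mem P hP =>
      obtain ⟨p, q, hpq, rfl⟩ := hP
      exact fun _ => h p q hpq
    | zero => exact fun hP => (map_zero F).trans (map_zero G).symm
    | add P Q hP hQ h1 h2 =>
      rw [← V_eq_span] at hP hQ
      intro _
      have := congrArg₂ (· + ·) (h1 hP) (h2 hQ)
      simp only [← map_add] at this
      exact this
    | smul c P hP h1 =>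
      rw [← V_eq_span] at hP
      intro _
      have := congrArg (c • ·) (h1 hP)
      simp only [← map_smul] at this
      exact this
  ext v
  exact key v (by rw [← V_eq_span]; exact v.2) v.2

/-! ### Evaluation at pairs of points and orbits of `SU(2)` -/

/-- The element of `SU(2)` with first row `(a, b)`. -/
def suTwo (a b : ℂ) (h : a * conj a + b * conj b = 1) : SU2 :=
  ⟨!![a, b; -conj b, conj a], by
    rw [Matrix.mem_specialUnitaryGroup_iff, Matrix.mem_unitaryGroup_iff]
    constructor
    · ext i j
      fin_cases i <;> fin_cases j <;>
        simp [Matrix.mul_apply, Fin.sum_univ_two, Matrix.star_apply] <;>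
        first | linear_combination h | ring
    · rw [Matrix.det_fin_two_of]
      linear_combination h⟩

theorem coe_suTwo (a b : ℂ) (h : a * conj a + b * conj b = 1) :
    (suTwo a b h : Matrix (Fin 2) (Fin 2) ℂ) = !![a, b; -conj b, conj a] := rfl

/-- The value of an element of `Pol ⊗ Pol` at a pair of points. -/
def biEval (u v : Fin 2 → ℂ) : Pol2 →ₐ[ℂ] ℂ :=
  Algebra.TensorProduct.productMap (MvPolynomial.aeval u) (MvPolynomial.aeval v)

theorem biEval_tmul (u v : Fin 2 → ℂ) (P Q : Pol) :
    biEval u v (P ⊗ₜ[ℂ] Q) = MvPolynomial.aeval u P * MvPolynomial.aeval v Q :=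
  Algebra.TensorProduct.productMap_apply_tmul _ _ _ _

theorem biEval_bimono (u v : Fin 2 → ℂ) (a b c d : ℕ) :
    biEval u v (bimono a b c d) = u 0 ^ a * u 1 ^ b * (v 0 ^ c * v 1 ^ d) := by
  rw [bimono, biEval_tmul, mono, mono]
  simp

theorem biEval_smul {p q : ℕ} {f : Pol2} (hf : f ∈ tens p q) (r s : ℂ) (u v : Fin 2 → ℂ) :
    biEval (r • u) (s • v) f = r ^ p * s ^ q * biEval u v f := by
  have : tens p q ≤ LinearMap.eqLocus (biEval (r • u) (s • v)).toLinearMap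
      ((r ^ p * s ^ q) • (biEval u v).toLinearMap) := by
    rw [tens_eq_span, Submodule.span_le]
    rintro _ ⟨a, b, c, d, rfl, rfl, rfl⟩
    rw [SetLike.mem_coe, LinearMap.mem_eqLocus, LinearMap.smul_apply, AlgHom.toLinearMap_apply,
      AlgHom.toLinearMap_apply, biEval_bimono, biEval_bimono]
    simp only [Pi.smul_apply, smul_eq_mul]
    ring
  exact this hf

/-- Evaluating at the standard pair after substituting `g` is evaluating at the rows of `g`.
Equivariance thus turns values at one pair into values along its orbit. -/
theorem biEval_tensorRep (g : SU2) (f : Pol2) :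
    biEval ![1, 0] ![0, 1] (tensorRep g f)
      = biEval ((g : Matrix (Fin 2) (Fin 2) ℂ) 0) ((g : Matrix (Fin 2) (Fin 2) ℂ) 1) f := by
  have h1 : (MvPolynomial.aeval ![(1 : ℂ), 0]).comp (subst (g : Matrix (Fin 2) (Fin 2) ℂ))
      = MvPolynomial.aeval ((g : Matrix (Fin 2) (Fin 2) ℂ) 0) := by
    refine MvPolynomial.algHom_ext fun i => ?_
    rw [AlgHom.comp_apply, subst_X]
    simp
  have h2 : (MvPolynomial.aeval ![(0 : ℂ), 1]).comp (subst (g : Matrix (Fin 2) (Fin 2) ℂ))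
      = MvPolynomial.aeval ((g : Matrix (Fin 2) (Fin 2) ℂ) 1) := by
    refine MvPolynomial.algHom_ext fun i => ?_
    rw [AlgHom.comp_apply, subst_X]
    simp
  have : (biEval ![1, 0] ![0, 1]).toLinearMap ∘ₗ tensorRep g
      = (biEval ((g : Matrix (Fin 2) (Fin 2) ℂ) 0)
        ((g : Matrix (Fin 2) (Fin 2) ℂ) 1)).toLinearMap := by
    refine TensorProduct.ext' fun P Q => ?_
    rw [LinearMap.comp_apply, tensorRep_tmul, AlgHom.toLinearMap_apply, AlgHom.toLinearMap_apply,
      biEval_tmul, biEval_tmul, ← AlgHom.comp_apply, ← AlgHom.comp_apply, h1, h2]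
  exact LinearMap.congr_fun this f

/-- A polynomial in `z` and `conj z` that vanishes everywhere is zero. -/
theorem eq_zero_of_eval_conj {P : Pol} (h : ∀ z : ℂ, MvPolynomial.aeval ![z, conj z] P = 0) :
    P = 0 := by
  -- `σ` passes to the coordinates `u, v` with `z = u + iv` and `conj z = u - iv`, and `τ` undoes
  -- it. The polynomial `σ P` vanishes on `ℝ × ℝ`, a product of infinite sets, hence is zero.
  let σ : Pol →ₐ[ℂ] Pol := MvPolynomial.aeval
    ![MvPolynomial.X 0 + MvPolynomial.C Complex.I * MvPolynomial.X 1,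
      MvPolynomial.X 0 - MvPolynomial.C Complex.I * MvPolynomial.X 1]
  let τ : Pol →ₐ[ℂ] Pol := MvPolynomial.aeval
    ![MvPolynomial.C (1 / 2) * (MvPolynomial.X 0 + MvPolynomial.X 1),
      MvPolynomial.C (-Complex.I / 2) * (MvPolynomial.X 0 - MvPolynomial.X 1)]
  have hτσ : τ.comp σ = AlgHom.id ℂ Pol := by
    have hI : (MvPolynomial.C Complex.I : Pol) * MvPolynomial.C (-Complex.I / 2)
        = MvPolynomial.C (1 / 2) := by
      rw [← MvPolynomial.C_mul]
      congr 1
      linear_combination (-1 / 2 : ℂ) * Complex.I_mul_I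
    have h2 : (MvPolynomial.C (1 / 2) : Pol) + MvPolynomial.C (1 / 2) = 1 := by
      rw [← MvPolynomial.C_add, ← MvPolynomial.C_1]
      congr 1
      norm_num
    refine MvPolynomial.algHom_ext fun i => ?_
    have hC : τ (MvPolynomial.C Complex.I) = MvPolynomial.C Complex.I :=
      MvPolynomial.algHom_C τ _
    have hX0 : τ (MvPolynomial.X 0)
        = MvPolynomial.C (1 / 2) * (MvPolynomial.X 0 + MvPolynomial.X 1) := by simp [τ]
    have hX1 : τ (MvPolynomial.X 1)
        = MvPolynomial.C (-Complex.I / 2) * (MvPolynomial.X 0 - MvPolynomial.X 1) := by simp [τ]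
    have hs0 : σ (MvPolynomial.X 0)
        = MvPolynomial.X 0 + MvPolynomial.C Complex.I * MvPolynomial.X 1 := by simp [σ]
    have hs1 : σ (MvPolynomial.X 1)
        = MvPolynomial.X 0 - MvPolynomial.C Complex.I * MvPolynomial.X 1 := by simp [σ]
    have hi : i = 0 ∨ i = 1 := by omega
    rcases hi with rfl | rfl
    · rw [AlgHom.comp_apply, hs0, map_add, map_mul, hC, hX0, hX1, AlgHom.id_apply]
      linear_combination (MvPolynomial.X 0 - MvPolynomial.X 1 : Pol) * hI
        + (MvPolynomial.X 0 : Pol) * h2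
    · rw [AlgHom.comp_apply, hs1, map_sub, map_mul, hC, hX0, hX1, AlgHom.id_apply]
      linear_combination -(MvPolynomial.X 0 - MvPolynomial.X 1 : Pol) * hI
        + (MvPolynomial.X 1 : Pol) * h2
  have hσ : σ P = 0 := by
    refine MvPolynomial.funext_set (fun _ => Set.range ((↑) : ℝ → ℂ))
      (fun _ => Set.infinite_range_of_injective Complex.ofReal_injective) fun x hx => ?_
    obtain ⟨u, hu⟩ := hx 0 trivial
    obtain ⟨v, hv⟩ := hx 1 trivial
    have hcomp : (MvPolynomial.aeval x).comp σ
        = MvPolynomial.aeval ![(u : ℂ) + Complex.I * v, conj ((u : ℂ) + Complex.I * v)] := by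
      refine MvPolynomial.algHom_ext fun i => ?_
      fin_cases i <;> simp [σ, ← hu, ← hv, sub_eq_add_neg]
    have := AlgHom.congr_fun hcomp P
    rw [h, AlgHom.comp_apply] at this
    simpa [MvPolynomial.aeval_eq_eval] using this
  rw [← AlgHom.id_apply (R := ℂ) P, ← hτσ, AlgHom.comp_apply, hσ, map_zero]

/-- The substitution `(x₁, y₁, x₂, y₂) ↦ (1, x, -y, 1)`. -/
def dehomogenize : Pol2 →ₐ[ℂ] Pol :=
  Algebra.TensorProduct.productMap (MvPolynomial.aeval ![1, MvPolynomial.X 0])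
    (MvPolynomial.aeval ![-MvPolynomial.X 1, 1])

theorem dehomogenize_bimono (a b c d : ℕ) :
    dehomogenize (bimono a b c d) = (-1 : ℂ) ^ c • mono b c := by
  rw [bimono, dehomogenize, Algebra.TensorProduct.productMap_apply_tmul, mono, mono, mono]
  simp only [map_mul, map_pow, MvPolynomial.aeval_X, Matrix.cons_val_zero, Matrix.cons_val_one,
    one_pow, one_mul, mul_one]
  rw [neg_pow, MvPolynomial.smul_eq_C_mul]
  simp only [MvPolynomial.C_pow, MvPolynomial.C_neg, MvPolynomial.C_1]
  ring

/-- In a fixed bidegree the exponents of `y₁` and `x₂` determine the other two, so setting `x₁ = y₂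
= 1` loses nothing. -/
theorem dehomogenize_eq_zero {p q : ℕ} {f : Pol2} (hf : f ∈ tens p q)
    (h : dehomogenize f = 0) : f = 0 := by
  refine eq_zero_of_bicoeff fun a b c d => ?_
  by_cases hd : a + b = p ∧ c + d = q
  · have : tens p q ≤ LinearMap.eqLocus (bicoeff a b c d)
        ((-1 : ℂ) ^ c • MvPolynomial.lcoeff ℂ (expo b c) ∘ₗ dehomogenize.toLinearMap) := by
      rw [tens_eq_span, Submodule.span_le]
      rintro _ ⟨a', b', c', d', h1, h2, rfl⟩
      rw [SetLike.mem_coe, LinearMap.mem_eqLocus, LinearMap.smul_apply, LinearMap.comp_apply,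
        AlgHom.toLinearMap_apply, dehomogenize_bimono, map_smul, MvPolynomial.lcoeff_apply,
        coeff_mono, bicoeff_bimono]
      by_cases hbc : b = b' ∧ c = c'
      · obtain ⟨rfl, rfl⟩ := hbc
        rw [if_pos (by omega), if_pos ⟨rfl, rfl⟩, smul_smul, ← mul_pow]
        simp
      · rw [if_neg (by tauto), if_neg hbc, smul_zero, smul_zero]
    have h3 := this hf
    rw [LinearMap.mem_eqLocus, LinearMap.smul_apply, LinearMap.comp_apply,
      AlgHom.toLinearMap_apply, h, map_zero, smul_zero] at h3
    exact h3
  · exact bicoeff_eq_zero hf hd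

theorem aeval_dehomogenize (z : ℂ) (f : Pol2) :
    MvPolynomial.aeval ![z, conj z] (dehomogenize f) = biEval ![1, z] ![-conj z, 1] f := by
  have : (MvPolynomial.aeval ![z, conj z]).toLinearMap ∘ₗ dehomogenize.toLinearMap
      = (biEval ![1, z] ![-conj z, 1]).toLinearMap := by
    refine linearMap_ext_bimono fun a b c d => ?_
    rw [LinearMap.comp_apply, AlgHom.toLinearMap_apply, AlgHom.toLinearMap_apply,
      AlgHom.toLinearMap_apply, dehomogenize_bimono, biEval_bimono, map_smul, mono, neg_pow]
    simp
    ring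
  exact LinearMap.congr_fun this f

/-- An equivariant map is determined by its values at the pair `(1,0)`, `(0,1)`. -/
theorem eq_zero_of_biEval {d₁ d₂ d : ℕ} {F : V d →ₗ[ℂ] Pol2} (hmem : ∀ v, F v ∈ tens d₁ d₂)
    (hF : ∀ (g : SU2) (v : V d), F (spinRep d g v) = tensorRep g (F v))
    (h : ∀ v, biEval ![1, 0] ![0, 1] (F v) = 0) : F = 0 := by
  ext1 v
  refine dehomogenize_eq_zero (hmem v) (eq_zero_of_eval_conj fun z => ?_)
  rw [aeval_dehomogenize]
  have hz : (0 : ℝ) < 1 + Complex.normSq z := by have := Complex.normSq_nonneg z; linarith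
  -- With this `r` the vectors `r(1, z)` and `r(-conj z, 1)` are the rows of an element of `SU(2)`;
  -- bihomogeneity then removes `r`.
  set r : ℂ := (((√(1 + Complex.normSq z))⁻¹ : ℝ) : ℂ) with hr
  have hr0 : r ≠ 0 := by
    rw [hr, Complex.ofReal_ne_zero]
    exact inv_ne_zero (Real.sqrt_ne_zero'.mpr hz)
  have hconj : conj r = r := Complex.conj_ofReal _
  have hrr : r * r * (1 + z * conj z) = 1 := by
    rw [Complex.mul_conj, hr, ← Complex.ofReal_mul, ← mul_inv, Real.mul_self_sqrt hz.le]
    rw [← Complex.ofReal_one, ← Complex.ofReal_add, ← Complex.ofReal_mul,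
      inv_mul_cancel₀ hz.ne']
  have hg : r * conj r + r * z * conj (r * z) = 1 := by
    rw [map_mul, hconj]
    linear_combination hrr
  have h1 := h (spinRep d (suTwo r (r * z) hg) v)
  rw [hF, biEval_tensorRep, coe_suTwo] at h1
  have e1 : (!![r, r * z; -conj (r * z), conj r] : Matrix (Fin 2) (Fin 2) ℂ) 0 = r • ![1, z] := by
    ext i
    fin_cases i <;> simp
  have e2 : (!![r, r * z; -conj (r * z), conj r] : Matrix (Fin 2) (Fin 2) ℂ) 1
      = r • ![-conj z, 1] := by
    ext i
    fin_cases i <;> simp [hconj]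
  rw [e1, e2, biEval_smul (hmem v)] at h1
  exact (mul_eq_zero.mp h1).resolve_left (mul_ne_zero (pow_ne_zero _ hr0) (pow_ne_zero _ hr0))

/-- A diagonal element with entries `ζ, conj ζ` only rescales the evaluation pair. Comparing the
scalars on the two sides of the equivariance leaves room only for monomials with `i - j = d₁ - d₂`.
-/
theorem biEval_eq_zero_of_weight {d₁ d₂ d : ℕ} {F : V d →ₗ[ℂ] Pol2}
    (hmem : ∀ v, F v ∈ tens d₁ d₂)
    (hF : ∀ (g : SU2) (v : V d), F (spinRep d g v) = tensorRep g (F v)) {i j : ℕ}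
    (hij : i + j = d) (hne : i + d₂ ≠ d₁ + j) :
    biEval ![1, 0] ![0, 1] (F ⟨mono i j, mono_mem_V_of_eq hij⟩) = 0 := by
  have hM : i + j + d₁ + d₂ + 1 ≠ 0 := Nat.succ_ne_zero _
  -- The order of `ζ` exceeds both `i + d₂` and `d₁ + j`, so unequal exponents give unequal powers.
  have hζ := Complex.isPrimitiveRoot_exp (i + j + d₁ + d₂ + 1) hM
  generalize Complex.exp (2 * Real.pi * Complex.I / (i + j + d₁ + d₂ + 1 : ℕ)) = ζ at hζ
  have hζ1 : ζ * conj ζ = 1 := by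
    rw [Complex.mul_conj, Complex.normSq_eq_norm_sq, hζ.norm'_eq_one hM]
    simp
  have hg : ζ * conj ζ + 0 * conj 0 = 1 := by rw [hζ1]; simp
  set v : V d := ⟨mono i j, mono_mem_V_of_eq hij⟩ with hv
  have h1 : spinRep d (suTwo ζ 0 hg) v = (ζ ^ i * conj ζ ^ j) • v := by
    apply Subtype.ext
    rw [coe_spinRep]
    change subst _ (mono i j) = (ζ ^ i * conj ζ ^ j) • mono i j
    rw [coe_suTwo, mono, map_mul, map_pow, map_pow, subst_X, subst_X]
    simp [smul_pow, smul_smul, mul_comm]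
  have h2 := congrArg (biEval ![1, 0] ![0, 1]) (hF (suTwo ζ 0 hg) v)
  have e1 : (!![ζ, 0; -conj 0, conj ζ] : Matrix (Fin 2) (Fin 2) ℂ) 0 = ζ • ![1, 0] := by
    ext i
    fin_cases i <;> simp
  have e2 : (!![ζ, 0; -conj 0, conj ζ] : Matrix (Fin 2) (Fin 2) ℂ) 1 = conj ζ • ![0, 1] := by
    ext i
    fin_cases i <;> simp
  rw [biEval_tensorRep, coe_suTwo, e1, e2, biEval_smul (hmem v), h1, map_smul, map_smul,
    smul_eq_mul] at h2
  by_contra hx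
  have h3 := mul_right_cancel₀ hx h2
  have h4 : ζ ^ (i + d₂) = ζ ^ (d₁ + j) := by
    have e3 : (ζ * conj ζ) ^ j = 1 := by rw [hζ1, one_pow]
    have e4 : (ζ * conj ζ) ^ d₂ = 1 := by rw [hζ1, one_pow]
    calc ζ ^ (i + d₂) = ζ ^ i * conj ζ ^ j * (ζ ^ j * ζ ^ d₂) := by
          rw [mul_pow] at e3
          linear_combination -(ζ ^ i * ζ ^ d₂) * e3
      _ = ζ ^ (d₁ + j) := by
          rw [h3]
          rw [mul_pow] at e4
          linear_combination (ζ ^ d₁ * ζ ^ j) * e4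
  exact hne (hζ.pow_inj (by omega) (by omega) h4)

/-- Two intertwining maps into `V_{d₁/2} ⊗ V_{d₂/2}` with the same normalization are equal. -/
theorem IsCGMap.unique {d₁ d₂ d i j : ℕ} (hij : i + j = d) (hd : i + d₂ = d₁ + j)
    {Φ Φ' : V d →ₗ[ℂ] Pol2} (h : IsCGMap d₁ d₂ d Φ) (h' : IsCGMap d₁ d₂ d Φ') : Φ = Φ' := by
  -- Only the monomial `x^i y^j` can have a nonzero value at the standard pair, so a single number
  -- decides whether an intertwining map vanishes. Hence these maps form a space of dimension at
  -- most one.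
  have hzero : ∀ F : V d →ₗ[ℂ] Pol2, (∀ v, F v ∈ tens d₁ d₂) →
      (∀ (g : SU2) (v : V d), F (spinRep d g v) = tensorRep g (F v)) →
      biEval ![1, 0] ![0, 1] (F ⟨mono i j, mono_mem_V_of_eq hij⟩) = 0 → F = 0 := by
    intro F hmem hF h0
    refine eq_zero_of_biEval hmem hF fun v => ?_
    have : (biEval ![1, 0] ![0, 1]).toLinearMap ∘ₗ F = 0 := by
      refine linearMap_ext_V fun p q hpq => ?_
      rw [LinearMap.comp_apply, AlgHom.toLinearMap_apply, LinearMap.zero_apply]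
      by_cases hp : p = i
      · obtain rfl : q = j := by omega
        subst hp
        exact h0
      · exact biEval_eq_zero_of_weight hmem hF hpq (by omega)
    exact LinearMap.congr_fun this v
  obtain ⟨hm, hi, he, hp⟩ := h
  obtain ⟨hm', hi', he', hp'⟩ := h'
  set α := biEval ![1, 0] ![0, 1] (Φ ⟨mono i j, mono_mem_V_of_eq hij⟩) with hα
  set α' := biEval ![1, 0] ![0, 1] (Φ' ⟨mono i j, mono_mem_V_of_eq hij⟩) with hα'
  have hα0 : α ≠ 0 := by
    intro h0
    rw [hzero Φ hm he h0] at hp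
    simp at hp
  have hlin : α • Φ' - α' • Φ = 0 := by
    refine hzero _ (fun v => ?_) (fun g v => ?_) ?_
    · exact Submodule.sub_mem _ (Submodule.smul_mem _ _ (hm' v)) (Submodule.smul_mem _ _ (hm v))
    · simp only [LinearMap.sub_apply, LinearMap.smul_apply, he, he', map_sub, map_smul]
    · simp only [LinearMap.sub_apply, LinearMap.smul_apply, map_sub, map_smul, ← hα, ← hα',
        smul_eq_mul]
      ring
  obtain ⟨c, hc⟩ : ∃ c : ℂ, ∀ v, Φ' v = c • Φ v := by
    refine ⟨α⁻¹ * α', fun v => ?_⟩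
    have := LinearMap.congr_fun hlin v
    rw [LinearMap.sub_apply, LinearMap.smul_apply, LinearMap.smul_apply, LinearMap.zero_apply,
      sub_eq_zero] at this
    rw [mul_smul, ← this, inv_smul_smul₀ hα0]
  rw [hc, inner_smul_pol2] at hp'
  -- The two maps are now proportional: the positivity condition makes the factor positive, and
  -- isometry gives it modulus one.
  have hc0 : 0 < c := by
    by_contra hcon
    exact hcon (pos_of_mul_pos_left hp' hp.le)
  have hnorm : inner ℂ (psiV d d : Pol) (psiV d d) = (1 : ℂ) := by
    have : (psiV d d : Pol) = psi d d := by simp [psiV]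
    rw [this, inner_psi le_rfl le_rfl, if_pos rfl]
  have hc1 : conj c * c = 1 := by
    have h1 := hi' (psiV d d) (psiV d d)
    rw [hc, smul_inner_pol2, inner_smul_pol2, hi, hnorm, mul_one] at h1
    exact h1
  have hcr : c = ((c.re : ℝ) : ℂ) := by
    apply Complex.ext
    · simp
    · simpa using (Complex.pos_iff.mp hc0).2.symm
  have hre : c.re = 1 := by
    have hpos := (Complex.pos_iff.mp hc0).1
    rw [hcr, Complex.conj_ofReal, ← Complex.ofReal_mul, ← Complex.ofReal_one,
      Complex.ofReal_inj] at hc1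
    nlinarith
  ext1 v
  rw [hc, hcr, hre, Complex.ofReal_one, one_smul]

/-! ### Hahn polynomials as coefficients -/

theorem cast_mul_choose_pred (a A : ℕ) :
    (a : ℂ) * ((a - 1).choose A : ℂ) = ((a : ℂ) - A) * (a.choose A : ℂ) := by
  rcases a with _ | a
  · rcases A with _ | A <;> simp
  · rw [Nat.add_sub_cancel]
    by_cases h : A ≤ a + 1
    · have := Nat.choose_mul_succ_eq a A
      rw [← Nat.cast_sub h]
      exact_mod_cast (mul_comm _ _).trans (this.trans (mul_comm _ _))
    · rw [Nat.choose_eq_zero_of_lt (by omega), Nat.choose_eq_zero_of_lt (by omega)]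
      simp

/-- `(D*)^p / p!` is the part of the substitution `x₁ ↦ x₁ + x₂`, `y₁ ↦ y₁ + y₂` that moves exactly
`p` factors, whence the product of binomials. In the induction the two terms combine through `(a -
A) + (b - B) = p + 1`. -/
theorem bicoeff_polarRaise_pow (A B C D p a b c d : ℕ) :
    bicoeff A B C D ((polarRaise ^ p) (bimono a b c d))
      = if a + c = A + C ∧ b + d = B + D ∧ a + b = A + B + p then
          (p.factorial : ℂ) * (a.choose A : ℂ) * (b.choose B : ℂ) else 0 := by
  induction p generalizing a b c d with
  | zero =>
    rw [pow_zero, Module.End.one_apply, bicoeff_bimono]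
    by_cases h : a = A ∧ b = B
    · obtain ⟨rfl, rfl⟩ := h
      by_cases h' : C = c ∧ D = d
      · rw [if_pos ⟨⟨rfl, rfl⟩, h'⟩, if_pos (by omega)]
        simp
      · rw [if_neg (by tauto), if_neg (by omega)]
    · rw [if_neg (by omega)]
      split_ifs with h'
      · by_cases ha : a < A
        · rw [Nat.choose_eq_zero_of_lt ha]; simp
        · rw [Nat.choose_eq_zero_of_lt (show b < B by omega)]; simp
      · rfl
  | succ p ih =>
    rw [pow_succ, Module.End.mul_apply, polarRaise_bimono, map_add, map_smul, map_smul, map_add,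
      map_smul, map_smul, ih, ih, smul_eq_mul, smul_eq_mul]
    by_cases h : a + c = A + C ∧ b + d = B + D ∧ a + b = A + B + (p + 1)
    · rw [if_pos h]
      have h1 : (a : ℂ) * (if a - 1 + (c + 1) = A + C ∧ b + d = B + D ∧ a - 1 + b = A + B + p then
          (p.factorial : ℂ) * ((a - 1).choose A : ℂ) * (b.choose B : ℂ) else 0)
            = p.factorial * (((a : ℂ) - A) * (a.choose A : ℂ)) * (b.choose B : ℂ) := by
        rw [← cast_mul_choose_pred]
        rcases a with _ | a
        · simp
        · rw [if_pos (by omega)]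
          ring
      have h2 : (b : ℂ) * (if a + c = A + C ∧ b - 1 + (d + 1) = B + D ∧ a + (b - 1) = A + B + p then
          (p.factorial : ℂ) * (a.choose A : ℂ) * ((b - 1).choose B : ℂ) else 0)
            = p.factorial * (a.choose A : ℂ) * (((b : ℂ) - B) * (b.choose B : ℂ)) := by
        rw [← cast_mul_choose_pred]
        rcases b with _ | b
        · simp
        · rw [if_pos (by omega)]
          ring
      rw [h1, h2, Nat.factorial_succ]
      have h3 : (a : ℂ) + b = A + B + (p + 1) := by exact_mod_cast h.2.2
      push_cast
      linear_combination (p.factorial : ℂ) * (a.choose A : ℂ) * (b.choose B : ℂ) * h3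
    · rw [if_neg h]
      have h1 : (a : ℂ) * (if a - 1 + (c + 1) = A + C ∧ b + d = B + D ∧ a - 1 + b = A + B + p then
          (p.factorial : ℂ) * ((a - 1).choose A : ℂ) * (b.choose B : ℂ) else 0) = 0 := by
        rcases a with _ | a
        · simp
        · rw [if_neg (by omega), mul_zero]
      have h2 : (b : ℂ) * (if a + c = A + C ∧ b - 1 + (d + 1) = B + D ∧ a + (b - 1) = A + B + p then
          (p.factorial : ℂ) * (a.choose A : ℂ) * ((b - 1).choose B : ℂ) else 0) = 0 := by
        rcases b with _ | b
        · simp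
        · rw [if_neg (by omega), mul_zero]
      rw [h1, h2, add_zero]

/-- Since `a - b = c - e`, the same factorial is the remaining denominator of `binom(a, b)` and of
`c!/(c-e)!`. If `e > c`, both sides vanish. -/
theorem choose_mul_factorial_eq_descFactorial {a b c e : ℕ} (h : a + e = b + c) :
    a.choose b * c.factorial * b.factorial = a.factorial * c.descFactorial e := by
  by_cases hec : e ≤ c
  · obtain ⟨t, rfl⟩ := Nat.exists_eq_add_of_le' hec
    obtain rfl : a = b + t := by omega
    have h1 := Nat.add_choose_mul_factorial_mul_factorial b t
    have h2 := Nat.factorial_mul_descFactorial (Nat.le_add_left e t)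
    rw [Nat.add_sub_cancel] at h2
    rw [← Nat.choose_symm_add] at h1
    rw [← h1, ← h2]
    ring
  · rw [Nat.choose_eq_zero_of_lt (by omega), Nat.descFactorial_eq_zero_iff_lt.mpr (by omega)]
    simp

theorem ascPochhammer_eval_succ (a k : ℕ) :
    (ascPochhammer ℤ k).eval ((a : ℤ) + 1) * (a.factorial : ℤ) = ((a + k).factorial : ℤ) := by
  rw [← Nat.cast_succ, ← ascPochhammer_eval_cast, ascPochhammer_nat_eq_ascFactorial,
    ← Nat.factorial_mul_ascFactorial, mul_comm]
  push_cast
  rfl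

theorem ascPochhammer_eval_neg_cast (a k : ℕ) :
    (ascPochhammer ℤ k).eval (-(a : ℤ)) = (-1) ^ k * (a.descFactorial k : ℤ) := by
  rw [ascPochhammer_eval_neg_eq_descPochhammer, descPochhammer_eval_eq_descFactorial]

/-- The sum that gives the coefficients of `cgMap`. -/
def coeffSum (n m k h w : ℕ) : ℤ :=
  ∑ j ∈ Finset.range (k + 1), (-1) ^ j * (k.choose j : ℤ) * ((h - k + (k - j)).choose (h + w - m) : ℤ)
    * ((n - h - k + j).choose (n - h - w) : ℤ)

/-- The identity holds term by term once the Hahn sum is reversed by `j ↦ k - j`. The factors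
`(h-k)!` and `(n-h-k)!` complete two of the rising factorials to factorials; the other two are
signed falling factorials of `w` and `m - w`, which turn into binomials. -/
theorem hahnE_mul_factorial {n m k h w : ℕ} (hk : k ≤ h) (hh : h + k ≤ n) (hw : w ≤ m)
    (hmw : m ≤ h + w) (hwn : h + w ≤ n) :
    hahnE k (n - h) h m w * ((h - k).factorial * (n - h - k).factorial : ℕ)
      = coeffSum n m k h w
        * (w.factorial * (m - w).factorial * (h + w - m).factorial * (n - h - w).factorial : ℕ) := by
  have hsub : Finset.Icc (w + k - m) (min k w) ⊆ Finset.range (k + 1) := by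
    intro j hj
    rw [Finset.mem_Icc] at hj
    rw [Finset.mem_range]
    omega
  rw [hahnE, coeffSum, Finset.sum_subset hsub]
  · rw [← Finset.sum_flip, Finset.sum_mul, Finset.sum_mul]
    refine Finset.sum_congr rfl fun j hj => ?_
    obtain ⟨i, rfl⟩ := Nat.exists_eq_add_of_le (Nat.lt_succ_iff.mp (Finset.mem_range.mp hj))
    obtain ⟨s, rfl⟩ := Nat.exists_eq_add_of_le hk
    obtain ⟨t, rfl⟩ := Nat.exists_eq_add_of_le hh
    obtain ⟨v, rfl⟩ := Nat.exists_eq_add_of_le hw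
    have a1 : j + i - j = i := by omega
    have a2 : j + i - i = j := by omega
    have a3 : j + i + s - (j + i) = s := by omega
    have a4 : j + i + s + (j + i) + t - (j + i + s) = j + i + t := by omega
    have a5 : j + i + t - (j + i) = t := by omega
    have a6 : w + v - w = v := by omega
    rw [a1, a2, a3, a4, a5, a6]
    have b1 : ((j + i + s : ℕ) : ℤ) - ((j + i : ℕ) : ℤ) + 1 = (s : ℤ) + 1 := by push_cast; ring
    have b2 : ((j + i + t : ℕ) : ℤ) - ((j + i : ℕ) : ℤ) + 1 = (t : ℤ) + 1 := by push_cast; ring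
    have b3 : (w : ℤ) - ((w + v : ℕ) : ℤ) = -(v : ℤ) := by push_cast; ring
    rw [b1, b2, b3, ascPochhammer_eval_neg_cast, ascPochhammer_eval_neg_cast]
    have c1 := ascPochhammer_eval_succ s i
    have c2 := ascPochhammer_eval_succ t j
    have c3 := choose_mul_factorial_eq_descFactorial (a := s + i) (b := j + i + s + w - (w + v))
      (c := v) (e := j) (by omega)
    have c4 := choose_mul_factorial_eq_descFactorial (a := t + j) (b := j + i + t - w)
      (c := w) (e := i) (by omega)
    have c5 := Nat.choose_symm_add (a := j) (b := i)
    have c3' : ((s + i).choose (j + i + s + w - (w + v)) : ℤ) * (v.factorial : ℤ)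
        * ((j + i + s + w - (w + v)).factorial : ℤ)
        = ((s + i).factorial : ℤ) * (v.descFactorial j : ℤ) := by exact_mod_cast c3
    have c4' : ((t + j).choose (j + i + t - w) : ℤ) * (w.factorial : ℤ)
        * ((j + i + t - w).factorial : ℤ)
        = ((t + j).factorial : ℤ) * (w.descFactorial i : ℤ) := by exact_mod_cast c4
    rw [← c5]
    have hs : ((-1 : ℤ) ^ i) * (-1) ^ i = 1 := by rw [← mul_pow]; simp
    push_cast
    calc _ = ((-1 : ℤ) ^ i * (-1) ^ i) * (-1) ^ j * ((j + i).choose j : ℤ)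
          * ((Polynomial.eval ((s : ℤ) + 1) (ascPochhammer ℤ i) * (s.factorial : ℤ))
            * (v.descFactorial j : ℤ))
          * ((Polynomial.eval ((t : ℤ) + 1) (ascPochhammer ℤ j) * (t.factorial : ℤ))
            * (w.descFactorial i : ℤ)) := by ring
      _ = _ := by
        rw [c1, c2, hs, ← c3', ← c4']
        ring
  -- Outside the summation limits one has `j > w` or `k - j > m - w`, and a falling factorial
  -- vanishes; so the sum may run over all `j ≤ k`.
  · intro j hj hnot
    rw [Finset.mem_range] at hj
    rw [Finset.mem_Icc] at hnot
    have b3 : (w : ℤ) - (m : ℤ) = -((m - w : ℕ) : ℤ) := by rw [Nat.cast_sub hw]; ring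
    rw [b3, ascPochhammer_eval_neg_cast, ascPochhammer_eval_neg_cast]
    by_cases hjw : w < j
    · rw [Nat.descFactorial_eq_zero_iff_lt.mpr hjw]; simp
    · rw [Nat.descFactorial_eq_zero_iff_lt.mpr (show m - w < k - j by omega)]; simp

theorem bicoeff_raise_kerEmb {n m k h w : ℕ} (hk : k ≤ h) (hh : h + k ≤ n) (hw : w ≤ m)
    (hmw : m ≤ h + w) (hwn : h + w ≤ n) (hkm : k ≤ m) :
    bicoeff (h + w - m) (n - h - w) (m - w) w
        ((polarRaise ^ (m - k)) (kerEmb k (mono (h - k) (n - h - k))))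
      = ((m - k).factorial : ℂ) * (coeffSum n m k h w : ℂ) := by
  rw [kerEmb_mono, map_sum, map_sum, coeffSum, Int.cast_sum, Finset.mul_sum]
  refine Finset.sum_congr rfl fun j hj => ?_
  rw [Finset.mem_range] at hj
  rw [map_smul, map_smul, bicoeff_polarRaise_pow, if_pos (by omega), smul_eq_mul]
  push_cast
  ring

/-! ### The normalized intertwining map -/

theorem cgSummand_le_tens {n m k : ℕ} (hm : m ≤ n) (hk : k ≤ m) :
    cgSummand n m k ≤ tens (n - m) m := by
  rw [← summand_tensGrade (hk.trans hm), ← tensGrade_of_le hm]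
  exact (isLadder_tensGrade n).summand_le hk

theorem inner_bimono_left (a b c d : ℕ) (f : Pol2) :
    inner ℂ (bimono a b c d) f
      = (((a + b).choose a : ℂ))⁻¹ * (((c + d).choose c : ℂ))⁻¹ * bicoeff a b c d f := by
  have : (innerSL ℂ (bimono a b c d)).toLinearMap
      = ((((a + b).choose a : ℂ))⁻¹ * (((c + d).choose c : ℂ))⁻¹) • bicoeff a b c d := by
    refine linearMap_ext_bimono fun a' b' c' d' => ?_
    rw [LinearMap.smul_apply, bicoeff_bimono]
    change inner ℂ (bimono a b c d) (bimono a' b' c' d') = _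
    rw [inner_bimono]
    split_ifs <;> simp
  exact LinearMap.congr_fun this f

theorem sqrt_mul_inv (x : ℝ) (hx : 0 < x) : √x * x⁻¹ = (√x)⁻¹ := by
  have h := Real.sqrt_pos.mpr hx
  field_simp
  exact Real.sq_sqrt hx.le

theorem inner_psi_tmul_psi {p q a b c d : ℕ} (hp : a + b = p) (hq : c + d = q) (f : Pol2) :
    inner ℂ (psi p b ⊗ₜ[ℂ] psi q d) f
      = (((√(p.choose a : ℝ))⁻¹ * (√(q.choose c : ℝ))⁻¹ : ℝ) : ℂ) * bicoeff a b c d f := by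
  subst hp hq
  have e : psi (a + b) b ⊗ₜ[ℂ] psi (c + d) d
      = (((√((a + b).choose a : ℝ) : ℝ) : ℂ) * ((√((c + d).choose c : ℝ) : ℝ) : ℂ))
        • bimono a b c d := by
    rw [psi, psi, Nat.add_sub_cancel, Nat.add_sub_cancel, TensorProduct.smul_tmul_smul, bimono]
  have h1 := sqrt_mul_inv ((a + b).choose a)
    (Nat.cast_pos.mpr (Nat.choose_pos (Nat.le_add_right a b)))
  have h2 := sqrt_mul_inv ((c + d).choose c)
    (Nat.cast_pos.mpr (Nat.choose_pos (Nat.le_add_right c d)))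
  rw [e, smul_inner_pol2, inner_bimono_left, map_mul, Complex.conj_ofReal, Complex.conj_ofReal,
    ← h1, ← h2]
  push_cast
  ring

theorem polarRaise_pow_bimono (N p : ℕ) :
    (polarRaise ^ p) (bimono 0 N 0 0) = (N.descFactorial p : ℂ) • bimono 0 (N - p) 0 p := by
  induction p with
  | zero => simp
  | succ p ih =>
    rw [pow_succ', Module.End.mul_apply, ih, map_smul, polarRaise_bimono, Nat.descFactorial_succ,
      Nat.cast_zero, zero_smul, zero_add, smul_smul, Nat.sub_sub]
    push_cast
    rw [mul_comm]

theorem polarRaise_pow_detPol_mul (k p : ℕ) (f : Pol2) :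
    (polarRaise ^ p) (detPol ^ k * f) = detPol ^ k * (polarRaise ^ p) f := by
  have h1 : ∀ g : Pol2, polarRaise (detPol ^ k * g) = detPol ^ k * polarRaise g := by
    induction k with
    | zero => simp
    | succ k ih =>
      intro g
      rw [pow_succ', mul_assoc, polarRaise_detPol_mul, ih, mul_assoc]
  induction p with
  | zero => simp
  | succ p ih =>
    rw [pow_succ', Module.End.mul_apply, Module.End.mul_apply, ih, h1]

/-- `Δ^k` can be pulled out of `(D*)^{m-k}`, which leaves only `y₁` and `y₂` in the other factor. So
only the term `(-y₁x₂)^k` contributes, and its sign is the one compensated in `cgIsometry`. -/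
theorem bicoeff_top {n m k : ℕ} (hm : m ≤ n) (hk : k ≤ min (n - m) m) :
    bicoeff 0 (n - m) k (m - k) ((polarRaise ^ (m - k)) (kerEmb k (mono 0 (n - 2 * k))))
      = (-1) ^ k * ((n - 2 * k).descFactorial (m - k) : ℂ) := by
  rw [kerEmb_mono', polarRaise_pow_detPol_mul, polarRaise_pow_bimono, mul_smul_comm, map_smul,
    detPol_pow, Finset.sum_mul, map_sum, Finset.sum_eq_single_of_mem k (by simp)]
  · rw [smul_mul_assoc, map_smul, bimono_mul, bicoeff_bimono, if_pos (by omega)]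
    simp [mul_comm]
  · intro j hj hne
    rw [Finset.mem_range] at hj
    rw [smul_mul_assoc, map_smul, bimono_mul, bicoeff_bimono, if_neg (by omega), smul_zero]

/-- The normalized intertwining map of `V_{n/2-k}` into `V_{(n-m)/2} ⊗ V_{m/2}`. -/
def cgIsometry (n m k : ℕ) : V (n - 2 * k) →ₗ[ℂ] Pol2 :=
  (((-1) ^ k * (√(cgFactor n m k))⁻¹ : ℝ) : ℂ) • cgMap n m k

theorem cgIsometry_psiV {n m k q : ℕ} (hq : q ≤ n - 2 * k) :
    cgIsometry n m k (psiV (n - 2 * k) q)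
      = (((-1) ^ k * (√(cgFactor n m k))⁻¹ * √((n - 2 * k).choose (n - 2 * k - q) : ℝ) : ℝ) : ℂ)
        • (polarRaise ^ (m - k)) (kerEmb k (mono (n - 2 * k - q) q)) := by
  have h : (psiV (n - 2 * k) q : Pol) = psi (n - 2 * k) q := by simp [psiV, hq]
  rw [cgIsometry, LinearMap.smul_apply, cgMap_apply, h, psi, map_smul, map_smul, smul_smul]
  push_cast
  rfl

theorem isCGMap_cgIsometry {n m k : ℕ} (hm : m ≤ n) (hk : k ≤ min (n - m) m) :
    IsCGMap (n - m) m (n - 2 * k) (cgIsometry n m k) := by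
  have hs : √(cgFactor n m k) * √(cgFactor n m k) = cgFactor n m k :=
    Real.mul_self_sqrt (cgFactor_pos n m k).le
  have hs0 := Real.sqrt_pos.mpr (cgFactor_pos n m k)
  have hsq : ((-1 : ℝ) ^ k) * (-1) ^ k = 1 := by rw [← mul_pow]; simp
  refine ⟨fun v => ?_, fun v v' => ?_, fun g v => ?_, ?_⟩
  · refine Submodule.smul_mem _ _ (cgSummand_le_tens (k := k) hm (by omega) ?_)
    rw [← range_cgMap (by omega)]
    exact LinearMap.mem_range_self _ v
  · have h1 : ((-1) ^ k * (√(cgFactor n m k))⁻¹) * ((-1) ^ k * (√(cgFactor n m k))⁻¹)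
        * cgFactor n m k = 1 := by
      rw [mul_mul_mul_comm, hsq, one_mul, ← mul_inv, hs, inv_mul_cancel₀ (cgFactor_pos n m k).ne']
    rw [cgIsometry, LinearMap.smul_apply, LinearMap.smul_apply, smul_inner_pol2, inner_smul_pol2,
      inner_cgMap hm hk, Complex.conj_ofReal, ← mul_assoc, ← mul_assoc, ← Complex.ofReal_mul,
      ← Complex.ofReal_mul, h1, Complex.ofReal_one, one_mul]
  · rw [cgIsometry, LinearMap.smul_apply, LinearMap.smul_apply, cgMap_equivariant, map_smul]
  -- The positivity condition concerns the monomial `y₁^{n-m} x₂^k y₂^{m-k}`; its coefficient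
  -- carries `(-1)^k`, which cancels the sign in the normalization.
  · rw [show (m + (n - 2 * k) - (n - m)) / 2 = m - k by omega, cgIsometry_psiV le_rfl,
      inner_psi_tmul_psi (a := 0) (b := n - m) (c := k) (d := m - k) (by omega) (by omega),
      map_smul, Nat.sub_self, bicoeff_top hm hk, smul_eq_mul]
    have e : (-1 : ℂ) ^ k * ((n - 2 * k).descFactorial (m - k) : ℂ)
        = (((-1) ^ k * ((n - 2 * k).descFactorial (m - k) : ℝ) : ℝ) : ℂ) := by push_cast; rfl
    rw [e, ← Complex.ofReal_mul, ← Complex.ofReal_mul, Complex.zero_lt_real]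
    have hd : 0 < ((n - 2 * k).descFactorial (m - k) : ℝ) :=
      Nat.cast_pos.mpr (Nat.descFactorial_pos.mpr (by omega))
    have hc : 0 < (m.choose k : ℝ) := Nat.cast_pos.mpr (Nat.choose_pos (by omega))
    have hc' := Real.sqrt_pos.mpr hc
    have : (√((n - m).choose 0 : ℝ))⁻¹ * (√(m.choose k : ℝ))⁻¹
        * ((-1) ^ k * (√(cgFactor n m k))⁻¹ * √((n - 2 * k).choose 0 : ℝ)
          * ((-1) ^ k * ((n - 2 * k).descFactorial (m - k) : ℝ)))
        = ((-1) ^ k * (-1) ^ k) * ((√(m.choose k : ℝ))⁻¹ * (√(cgFactor n m k))⁻¹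
          * ((n - 2 * k).descFactorial (m - k) : ℝ)) := by
      simp only [Nat.choose_zero_right, Nat.cast_one, Real.sqrt_one]
      ring
    rw [this, hsq, one_mul]
    positivity

theorem existsUnique_isCGMap {n m k : ℕ} (hm : m ≤ n) (hk : k ≤ min (n - m) m) :
    ∃! Φ : V (n - 2 * k) →ₗ[ℂ] Pol2, IsCGMap (n - m) m (n - 2 * k) Φ :=
  ⟨cgIsometry n m k, isCGMap_cgIsometry hm hk, fun _ hΦ =>
    -- These are the solutions of `i + j = n - 2k` and `i + m = (n - m) + j`.
    hΦ.unique (i := n - m - k) (j := m - k) (by omega) (by omega) (isCGMap_cgIsometry hm hk)⟩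

/-- The last factor on the right converts the coefficient sum into a Hahn polynomial. Being
nonnegative, it is the root of its square, and then both sides are roots of the same quotient of
factorials. -/
theorem sqrt_ratio {n m k h w : ℕ} (hm : m ≤ n) (hk : k ≤ h) (hh : h + k ≤ n)
    (hw : w ≤ m) (hmw : m ≤ h + w) (hwn : h + w ≤ n) :
    √((((h - k).factorial * (n - h - k).factorial * (m - k).factorial
          * (n - m - k).factorial * (n - 2 * k + 1) : ℕ) : ℝ)
        / (((m - w).factorial * (h + w - m).factorial * (n - h - w).factorial
          * w.factorial * (n - k + 1).factorial * k.factorial : ℕ) : ℝ))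
      = (√((n - m).choose (h + w - m) : ℝ))⁻¹ * (√(m.choose (m - w) : ℝ))⁻¹
        * ((√(cgFactor n m k))⁻¹ * √((n - 2 * k).choose (h - k) : ℝ))
        * ((((m - k).factorial * (h - k).factorial * (n - h - k).factorial : ℕ) : ℝ)
          / ((w.factorial * (m - w).factorial * (h + w - m).factorial
            * (n - h - w).factorial : ℕ) : ℝ)) := by
  have e : ∀ m : ℕ, (m.factorial : ℝ) ≠ 0 := fun m => Nat.cast_ne_zero.mpr (Nat.factorial_ne_zero m)
  have c1 : ((n - m).choose (h + w - m) : ℝ)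
      = (n - m).factorial / ((h + w - m).factorial * (n - h - w).factorial) := by
    rw [Nat.cast_choose ℝ (by omega), show n - m - (h + w - m) = n - h - w by omega]
  have c2 : (m.choose (m - w) : ℝ) = m.factorial / ((m - w).factorial * w.factorial) := by
    rw [Nat.cast_choose ℝ (by omega), Nat.sub_sub_self hw]
  have c3 : ((n - 2 * k).choose (h - k) : ℝ)
      = (n - 2 * k).factorial / ((h - k).factorial * (n - h - k).factorial) := by
    rw [Nat.cast_choose ℝ (by omega), show n - 2 * k - (h - k) = n - h - k by omega]
  set Y : ℝ := (((m - k).factorial * (h - k).factorial * (n - h - k).factorial : ℕ) : ℝ)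
          / ((w.factorial * (m - w).factorial * (h + w - m).factorial
            * (n - h - w).factorial : ℕ) : ℝ) with hY
  have hY0 : 0 ≤ Y := by positivity
  have hfac := cgFactor_pos n m k
  rw [← Real.sqrt_inv, ← Real.sqrt_inv, ← Real.sqrt_inv, ← Real.sqrt_mul (by positivity),
    ← Real.sqrt_mul (by positivity), ← Real.sqrt_mul (by positivity)]
  nth_rewrite 1 [← Real.sqrt_sq hY0]
  rw [← Real.sqrt_mul (by positivity), c1, c2, c3, hY, cgFactor]
  congr 1
  have e1 := e (n - m)
  have e2 := e m
  have e3 := e (n - 2 * k)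
  have e4 := e (h - k)
  have e5 := e (n - h - k)
  have e6 := e (m - w)
  have e7 := e w
  have e8 := e (h + w - m)
  have e9 := e (n - h - w)
  have e10 := e (m - k)
  have e11 := e (n - m - k)
  have e12 := e (n - k + 1)
  have e13 := e k
  push_cast
  field_simp

theorem cgCoeff_eq {n m k h w : ℕ} (hm : m ≤ n) (hkm : k ≤ min (n - m) m) (hk : k ≤ h)
    (hh : h + k ≤ n) (hw : w ≤ m) (hmw : m ≤ h + w) (hwn : h + w ≤ n) :
    cgCoeff (n - m) m (n - 2 * k) (n - h - w) w (n - k - h)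
      = (((-1) ^ k
          * √((((h - k).factorial * (n - h - k).factorial * (m - k).factorial
                  * (n - m - k).factorial * (n - 2 * k + 1) : ℕ) : ℝ)
              / (((m - w).factorial * (h + w - m).factorial * (n - h - w).factorial
                  * w.factorial * (n - k + 1).factorial * k.factorial : ℕ) : ℝ))
          * (hahnE k (n - h) h m w : ℝ) : ℝ) : ℂ) := by
  -- Uniqueness replaces the map chosen in the definition by the explicit isometry, whose
  -- coefficients are known.
  have hex := (existsUnique_isCGMap hm hkm).exists
  rw [cgCoeff, dif_pos hex,
    (existsUnique_isCGMap hm hkm).unique hex.choose_spec (isCGMap_cgIsometry hm hkm),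
    inner_psi_tmul_psi (a := h + w - m) (c := m - w) (by omega) (by omega),
    cgIsometry_psiV (by omega), map_smul, smul_eq_mul,
    show n - 2 * k - (n - k - h) = h - k by omega, show n - k - h = n - h - k by omega,
    bicoeff_raise_kerEmb hk hh hw hmw hwn (by omega), sqrt_ratio hm hk hh hw hmw hwn]
  have hE : (coeffSum n m k h w : ℝ)
      = (hahnE k (n - h) h m w : ℝ) * (((h - k).factorial * (n - h - k).factorial : ℕ) : ℝ)
        / ((w.factorial * (m - w).factorial * (h + w - m).factorial
          * (n - h - w).factorial : ℕ) : ℝ) := by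
    rw [eq_div_iff (by positivity)]
    exact_mod_cast (hahnE_mul_factorial hk hh hw hmw hwn).symm
  have e : ((m - k).factorial : ℂ) * (coeffSum n m k h w : ℂ)
      = (((m - k).factorial * (coeffSum n m k h w : ℝ) : ℝ) : ℂ) := by push_cast; rfl
  rw [e, hE, ← Complex.ofReal_mul, ← Complex.ofReal_mul, Complex.ofReal_inj]
  push_cast
  ring

end HahnClebschGordan

end

/-! ### Assembly of the theorem -/

open HahnClebschGordan in
theorem mainTheorem8 (n m : ℕ) (hm : m ≤ n) :
    -- the Johnson-scheme decomposition of `M^{n-m,m}`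
    (iSupIndep (fun k : Fin (min (n - m) m + 1) => johnsonSummand n m k) ∧
      ⨆ k : Fin (min (n - m) m + 1), johnsonSummand n m k = johnsonM n m) ∧
    -- the Clebsch--Gordan decomposition of `V_{(n-m)/2} ⊗ V_{m/2}`
    (iSupIndep (fun k : Fin (min (n - m) m + 1) => cgSummand n m k) ∧
      ⨆ k : Fin (min (n - m) m + 1), cgSummand n m k = tens (n - m) m) ∧
    ∀ k : ℕ, k ≤ min (n - m) m →
      -- the kernel and the `k`-th summand are copies of `V_{n/2-k}`
      IsoSpin (polarKer n k) (n - 2 * k) ∧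
      IsoSpin (cgSummand n m k) (n - 2 * k) ∧
      -- the kernel is the direct sum of the `X_h S^{n-k,k}`
      (iSupIndep (fun h : Finset.Icc k (n - k) => (specht n k).map (schurWeyl n h)) ∧
        ⨆ h : Finset.Icc k (n - k), (specht n k).map (schurWeyl n h) = polarKer n k) ∧
      -- the `k`-th summand is the direct sum of the `X_h R_{m-k} S^{n-k,k}`
      (iSupIndep (fun h : Finset.Icc k (n - k) => (johnsonSummand n m k).map (schurWeyl n h)) ∧
        ⨆ h : Finset.Icc k (n - k), (johnsonSummand n m k).map (schurWeyl n h)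
          = cgSummand n m k) ∧
      -- the normalized intertwining map defining the Clebsch--Gordan coefficients
      (∃! Φ : V (n - 2 * k) →ₗ[ℂ] Pol2, IsCGMap (n - m) m (n - 2 * k) Φ) ∧
      -- the Clebsch--Gordan coefficients are Hahn polynomials
      ∀ h w : ℕ, k ≤ h → h ≤ n - k → m - h ≤ w → w ≤ min (n - h) m →
        clebschGordan (((n : ℚ) - m) / 2) ((m : ℚ) / 2) ((n : ℚ) / 2 - k)
            (((n : ℚ) + m) / 2 - h - w) ((w : ℚ) - (m : ℚ) / 2) ((n : ℚ) / 2 - h)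
          = (((-1) ^ k
              * √((((h - k).factorial * (n - h - k).factorial * (m - k).factorial
                      * (n - m - k).factorial * (n - 2 * k + 1) : ℕ) : ℝ)
                  / (((m - w).factorial * (h + w - m).factorial * (n - h - w).factorial
                      * w.factorial * (n - k + 1).factorial * k.factorial : ℕ) : ℝ))
              * (hahnE k (n - h) h m w : ℝ) : ℝ) : ℂ) := by
  refine ⟨⟨?_, ?_⟩, ⟨?_, ?_⟩, fun k hk => ⟨isoSpin_polarKer (by omega), isoSpin_cgSummand hm hk,
    ⟨iSupIndep_map_schurWeyl n k _, iSup_map_schurWeyl_specht (by omega)⟩,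
    ⟨iSupIndep_map_schurWeyl n k _, iSup_map_schurWeyl_johnsonSummand (by omega)⟩,
    existsUnique_isCGMap hm hk, fun h w h1 h2 h3 h4 => ?_⟩⟩
  · simpa only [summand_johnsonM] using (isLadder_johnsonM n).iSupIndep_summand m
  · simpa only [summand_johnsonM] using (isLadder_johnsonM n).iSup_summand m hm
  · have := (isLadder_tensGrade n).iSupIndep_summand m
    have e : ∀ k : Fin (min (n - m) m + 1),
        IsLadder.summand (tensGrade n) polarLower polarRaise m k = cgSummand n m k :=
      fun k => summand_tensGrade (by have := k.2; omega)
    simpa only [e] using this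
  · have := (isLadder_tensGrade n).iSup_summand m hm
    have e : ∀ k : Fin (min (n - m) m + 1),
        IsLadder.summand (tensGrade n) polarLower polarRaise m k = cgSummand n m k :=
      fun k => summand_tensGrade (by have := k.2; omega)
    simpa only [e, tensGrade_of_le hm] using this
  -- In the given range of `h` and `w` all six combinations of half-integers are natural numbers, so
  -- the floors in the definition of the coefficient are exact.
  · have f1 : 2 * (((n : ℚ) - m) / 2) = ((n - m : ℕ) : ℚ) := by
      rw [Nat.cast_sub hm]; ring
    have f2 : 2 * ((m : ℚ) / 2) = (m : ℚ) := by ring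
    have f3 : 2 * ((n : ℚ) / 2 - k) = ((n - 2 * k : ℕ) : ℚ) := by
      rw [Nat.cast_sub (by omega)]; push_cast; ring
    have f4 : ((n : ℚ) - m) / 2 + (((n : ℚ) + m) / 2 - h - w) = ((n - h - w : ℕ) : ℚ) := by
      rw [Nat.cast_sub (by omega), Nat.cast_sub (by omega)]; ring
    have f5 : (m : ℚ) / 2 + ((w : ℚ) - (m : ℚ) / 2) = (w : ℚ) := by ring
    have f6 : (n : ℚ) / 2 - k + ((n : ℚ) / 2 - h) = ((n - k - h : ℕ) : ℚ) := by
      rw [Nat.cast_sub (by omega), Nat.cast_sub (by omega)]; ring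
    rw [clebschGordan, f1, f2, f3, f4, f5, f6]
    simp only [Nat.floor_natCast]
    exact cgCoeff_eq hm hk h1 (by omega) (by omega) (by omega) (by omega)
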